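/- Let $k$ be an algebraically closed field of characteristic zero. A modular category over $k$ is a semisimple $k$-linear abelian rigid monoidal category with finite-dimensional hom spaces, finitely many isomorphism classes of simple objects and simple unit $I$, equipped with a braiding $c$ and a ribbon twist $\theta$, such that the matrix $\big(\mathrm{tr}(c_{X,Y}c_{Y,X})\big)_{X,Y}$, indexed by the isomorphism classes of simple objects, is non-degenerate. Let $\mathcal{F}ib_u$ be a Fibonacci modular category with parameter $u\in k$: a modular category with exactly two simple objects $I\not\cong X$ up to isomorphism, such that $X\otimes X\cong I\oplus X$ and the braiding $c_{X,X}$ acts by precomposition on $\mathrm{Hom}(X\otimes X,X)$ as multiplication by $u$. (Every Fibonacci modular category has such a parameter.) **Theorem.** For every such $\mathcal{F}ib_u$ and every integer $\ell\ge 0$, the Deligne tensor power $\mathcal{F}ib_u^{\boxtimes\ell}$, with its factorwise braiding and twist, is completely anisotropic: every indecomposable, separable, commutative, ribbon algebra $A$ in $\mathcal{F}ib_u^{\boxtimes\ell}$ is trivial, that is, its unit map $I\to A$ is an isomorphism (of algebras). Here an algebra is an associative unital algebra $(A,\mu,\iota)$. It is commutative if $\mu c_{A,A}=\mu$, and ribbon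 if $\theta_A=1_A$. It is indecomposable if $A\neq 0$ and $A$ is not the direct sum of two non-zero algebras. It is separable if the pairing $e=\epsilon\mu:A\otimes A\to I$ is non-degenerate, that is, if there is $\kappa: I\to A\otimes A$ with $(e\otimes 1)(1\otimes\kappa)=1_A$, where $\epsilon:A\to I$ is the composite $A\xrightarrow{1\otimes \mathrm{coev}}A\otimes A\otimes A^*\xrightarrow{\mu\otimes 1}A\otimes A^*\xrightarrow{c_{A,A^*}}A^*\otimes A\xrightarrow{\mathrm{ev}}I$. -/

import Mathlib

open CategoryTheory MonoidalCategory Limits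

attribute [local instance] Abelian.hasFiniteBiproducts

universe w v v' u u'

/-! ### Ribbon, fusion and modular categories -/

/-- A ribbon twist on a rigid braided monoidal category: a natural automorphism of the identity
functor which is balanced, `θ_{X ⊗ Y} = c_{Y,X} c_{X,Y} (θ_X ⊗ θ_Y)`, and self-dual,
`θ_{X*} = (θ_X)*`. Here `X* = Xᘁ`, with evaluation `X* ⊗ X ⟶ 𝟙` and coevaluation `𝟙 ⟶ X ⊗ X*`. -/
class RibbonTwist (C : Type u) [Category.{v} C] [MonoidalCategory C] [BraidedCategory C]
    [RigidCategory C] where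
  /-- the twist on an object -/
  twist : ∀ X : C, X ≅ X
  twist_naturality : ∀ {X Y : C} (f : X ⟶ Y), f ≫ (twist Y).hom = (twist X).hom ≫ f
  twist_tensor : ∀ X Y : C, (twist (X ⊗ Y)).hom =
    ((twist X).hom ⊗ₘ (twist Y).hom) ≫ (β_ X Y).hom ≫ (β_ Y X).hom
  twist_dual : ∀ X : C, (twist (Xᘁ)).hom = ((twist X).hom)ᘁ

/-- The ribbon twist `θ_X : X ⟶ X`. -/
def ribbonTwist {C : Type u} [Category.{v} C] [MonoidalCategory C] [BraidedCategory C]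
    [RigidCategory C] [RibbonTwist C] (X : C) : X ⟶ X :=
  (RibbonTwist.twist X).hom

/-- The categorical trace `ev_X ∘ c_{X,X*} ∘ (θ_X f ⊗ 1) ∘ coev_X` of an endomorphism in a ribbon
category, as an endomorphism of the unit object. -/
def ribbonTrace {C : Type u} [Category.{v} C] [MonoidalCategory C] [BraidedCategory C]
    [RigidCategory C] [RibbonTwist C] {X : C} (f : X ⟶ X) : 𝟙_ C ⟶ 𝟙_ C :=
  η_ X (Xᘁ) ≫ ((f ≫ ribbonTwist X) ▷ (Xᘁ)) ≫ (β_ X (Xᘁ)).hom ≫ ε_ X (Xᘁ)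

/-- A finite list contains each isomorphism class of simple objects exactly once. -/
structure IsSimpleList {C : Type u} [Category.{v} C] [Abelian C] {n : ℕ} (S : Fin n → C) :
    Prop where
  simple : ∀ i, Simple (S i)
  injective : ∀ i j, Nonempty (S i ≅ S j) → i = j
  exhaustive : ∀ X : C, Simple X → ∃ i, Nonempty (X ≅ S i)

/-- Fusion categories over `k`: rigid `k`-linear monoidal categories (bilinear tensor product) which
are semisimple, with finite-dimensional hom spaces, finitely many simple objects up to isomorphism,
and simple unit. -/
structure IsFusion (k : Type w) [Field k] (C : Type u) [Category.{v} C] [Abelian C] [Linear k C]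
    [MonoidalCategory C] [MonoidalPreadditive C] [MonoidalLinear k C] [RigidCategory C] :
    Prop where
  finite_hom : ∀ X Y : C, FiniteDimensional k (X ⟶ Y)
  semisimple : ∀ X : C, ∃ (n : ℕ) (S : Fin n → C), (∀ i, Simple (S i)) ∧ Nonempty (X ≅ ⨁ S)
  finite_simple : ∃ (n : ℕ) (S : Fin n → C), IsSimpleList S
  simple_unit : Simple (𝟙_ C)

/-- Modular categories over `k`: ribbon fusion categories for which the matrix
`tr (c_{X,Y} c_{Y,X})`, with `X`, `Y` running over representatives of the isomorphism classes of
simple objects, is non-degenerate. -/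
structure IsModular (k : Type w) [Field k] (C : Type u) [Category.{v} C] [Abelian C] [Linear k C]
    [MonoidalCategory C] [MonoidalPreadditive C] [MonoidalLinear k C] [BraidedCategory C]
    [RigidCategory C] [RibbonTwist C] : Prop extends IsFusion k C where
  nondegenerate : ∀ (n : ℕ) (S : Fin n → C), IsSimpleList S → ∀ v : Fin n → k,
    (∀ i, ∑ j, v j • ribbonTrace ((β_ (S j) (S i)).hom ≫ (β_ (S i) (S j)).hom) = 0) → v = 0

/-- `C` is a Fibonacci modular category with parameter `u`: it is modular, its simple objects are,
up to isomorphism, exactly the unit and one further object `X`, one has `X ⊗ X ≅ 𝟙 ⊕ X`, and the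
braiding `c_{X,X}` acts on `Hom(X ⊗ X, X)` by precomposition as multiplication by `u`. -/
structure IsFibonacci (k : Type w) [Field k] (C : Type u) [Category.{v} C] [Abelian C]
    [Linear k C] [MonoidalCategory C] [MonoidalPreadditive C] [MonoidalLinear k C]
    [BraidedCategory C] [RigidCategory C] [RibbonTwist C] (u : k) : Prop
    extends IsModular k C where
  fibonacci : ∃ X : C, Simple X ∧ ¬ Nonempty (X ≅ 𝟙_ C) ∧
    (∀ Y : C, Simple Y → Nonempty (Y ≅ 𝟙_ C) ∨ Nonempty (Y ≅ X)) ∧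
    Nonempty (X ⊗ X ≅ 𝟙_ C ⊞ X) ∧
    ∀ f : X ⊗ X ⟶ X, (β_ X X).hom ≫ f = u • f

/-! ### Deligne tensor products -/

/-- `D` is the Deligne tensor product of the finite family `C i` of ribbon fusion categories: there
is a functor `(X i) ↦ ⊠ i, X i` from `∀ i, C i` to `D` which is `k`-multilinear on morphisms, with
`⨂ i, Hom (X i) (Y i) ≃ Hom (⊠ i, X i) (⊠ i, Y i)`, such that every object of `D` is a finite direct
sum of objects `⊠ i, X i`, and `(⊠ X i) ⊗ (⊠ Y i) ≅ ⊠ (X i ⊗ Y i)` coherently, where the braiding and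
the twist of `D` are the factorwise ones. Over an algebraically closed field this determines the
ribbon category `D` up to equivalence (it is the additive completion of the tensor product over `k`
of the categories `C i`), and when the `S i` are simple objects of the `C i` the objects `⊠ i, S i`
are the simple objects of `D`. -/
structure DeligneProduct (k : Type w) [Field k] {ι : Type} [Fintype ι]
    (C : ι → Type u) [∀ i, Category.{v} (C i)] [∀ i, Abelian (C i)] [∀ i, Linear k (C i)]
    [∀ i, MonoidalCategory (C i)] [∀ i, BraidedCategory (C i)] [∀ i, RigidCategory (C i)]
    [∀ i, RibbonTwist (C i)]
    (D : Type u') [Category.{v'} D] [Abelian D] [Linear k D] [MonoidalCategory D]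
    [MonoidalPreadditive D] [MonoidalLinear k D] [BraidedCategory D] [RigidCategory D]
    [RibbonTwist D] where
  /-- the external product functor -/
  box : (∀ i, C i) ⥤ D
  /-- the action of the external product on morphisms, as a multilinear map -/
  boxHom : ∀ X Y : ∀ i, C i,
    MultilinearMap k (fun i => (X i ⟶ Y i)) (box.obj X ⟶ box.obj Y)
  boxHom_apply : ∀ (X Y : ∀ i, C i) (f : X ⟶ Y), boxHom X Y f = box.map f
  boxHom_bijective : ∀ X Y : ∀ i, C i, Function.Bijective (PiTensorProduct.lift (boxHom X Y))
  generates : ∀ Z : D, ∃ (n : ℕ) (X : Fin n → ∀ i, C i),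
    Nonempty (Z ≅ ⨁ fun j => box.obj (X j))
  /-- the factorwise tensor product and braiding -/
  braided : box.Braided
  box_twist : ∀ X : ∀ i, C i, box.map (fun i => ribbonTwist (X i)) = ribbonTwist (box.obj X)

/-! ### Algebras in braided and ribbon categories -/

/-- The trace form `ε : A ⟶ 𝟙` of an algebra in a rigid braided category: the composite
`A → A ⊗ A ⊗ A* → A ⊗ A* → A* ⊗ A → 𝟙` of `1 ⊗ coev`, `μ ⊗ 1`, `c_{A,A*}` and `ev`. -/
def algTraceForm {C : Type u} [Category.{v} C] [MonoidalCategory C] [BraidedCategory C]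
    [RigidCategory C] (A : C) [MonObj A] : A ⟶ 𝟙_ C :=
  (ρ_ A).inv ≫ (A ◁ η_ A (Aᘁ)) ≫ (α_ A A (Aᘁ)).inv ≫ (MonObj.mul (X := A) ▷ (Aᘁ)) ≫
    (β_ A (Aᘁ)).hom ≫ ε_ A (Aᘁ)

/-- The pairing `e = ε μ : A ⊗ A ⟶ 𝟙`. -/
def algPairing {C : Type u} [Category.{v} C] [MonoidalCategory C] [BraidedCategory C]
    [RigidCategory C] (A : C) [MonObj A] : A ⊗ A ⟶ 𝟙_ C :=
  MonObj.mul (X := A) ≫ algTraceForm A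

/-- An algebra is separable if the pairing `e` is non-degenerate: there is `κ : 𝟙 ⟶ A ⊗ A` with
`(e ⊗ 1) (1 ⊗ κ) = 1`. -/
def IsSeparableAlg {C : Type u} [Category.{v} C] [MonoidalCategory C] [BraidedCategory C]
    [RigidCategory C] (A : C) [MonObj A] : Prop :=
  ∃ κ : 𝟙_ C ⟶ A ⊗ A,
    (ρ_ A).inv ≫ (A ◁ κ) ≫ (α_ A A A).inv ≫ (algPairing A ▷ A) ≫ (λ_ A).hom = 𝟙 A

/-- An algebra is indecomposable if it is non-zero and is not the direct sum (product) of two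
non-zero algebras. -/
def IsIndecomposableAlg {C : Type u} [Category.{v} C] [Abelian C] [MonoidalCategory C]
    (A : C) [MonObj A] : Prop :=
  ¬ IsZero A ∧ ∀ (B B' : C) [MonObj B] [MonObj B'] (p : A ⟶ B) (q : A ⟶ B') [IsMonHom p]
    [IsMonHom q], IsIso (biprod.lift p q) → IsZero B ∨ IsZero B'

/-- An algebra (taken commutative below) in a ribbon category is ribbon if its twist is trivial. -/
def IsRibbonAlg {C : Type u} [Category.{v} C] [MonoidalCategory C] [BraidedCategory C]
    [RigidCategory C] [RibbonTwist C] (A : C) : Prop :=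
  ribbonTwist A = 𝟙 A

/-- A ribbon category is completely anisotropic if each of its indecomposable, separable,
commutative, ribbon algebras is trivial, that is, its unit map `𝟙 ⟶ A` (which is always a
homomorphism of algebras) is an isomorphism. -/
def IsCompletelyAnisotropic (C : Type u) [Category.{v} C] [Abelian C] [MonoidalCategory C]
    [BraidedCategory C] [RigidCategory C] [RibbonTwist C] : Prop :=
  ∀ (A : C) [MonObj A] [IsCommMonObj A], IsIndecomposableAlg A → IsSeparableAlg A →
    IsRibbonAlg A → IsIso (MonObj.one (X := A))

/-! Let `X` be the nontrivial simple object of the Fibonacci category and `θ` the scalar of its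
twist. The simple objects of the Deligne power are the products `X_w` of generators over words `w`
without repeated letters, and `X_w` has twist `θ ^ w.length`. Since a ribbon algebra `A` has trivial
twist, it contains no simple of length 1 or 2 once `θ ≠ 1` and `θ² ≠ 1`. The first holds because a
trivial twist would make the category symmetric and its trace matrix of rank at most one
(`ribbonTwist_ne_id`); the second by comparing determinants of the three-strand braid action on the
plane `Hom(X ⊗ X ⊗ X, X)` (`twist_sq_ne_one`).

Higher powers of `θ` may be 1, so longer words need a different argument. Separability excludes
nilpotents and indecomposability excludes idempotents, so `Hom(𝟙, A)` consists of multiples of the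
unit (`IsIndecomposableAlg.exists_eq_smul_one`). Suppose that `A` contains no nonempty word shorter
than `n ≥ 3`. Moving letters across by self-duality and fusing equal ones shows that the free module
`X_v ⊗ A` has only scalar endomorphisms when `v` is shorter than `n` (`hom_word_eq_smul`).

Were a word `abR` of length `n` to occur in `A`, duality would give a nonzero map `X_a ⊗ A ⟶ X_{bR}
⊗ A` of free modules. Separability provides a map back with nonzero composite on `X_{bR} ⊗ A`, hence
a nonzero scalar there, so `X_{bR} ⊗ A` is a retract of `X_a ⊗ A`. Tensoring with `X_b` makes `X_b ⊗
X_b ⊗ X_R ⊗ A` a retract of `X_b ⊗ X_a ⊗ A`, which has only scalar endomorphisms because `2 < n`.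
But `X_b ⊗ X_b ≅ 𝟙 ⊕ X_b` gives `X_b ⊗ X_b ⊗ X_R` a nontrivial idempotent
(`hom_word_eq_zero_of_lt`). Hence only the unit occurs in `A`. -/

set_option linter.unusedSectionVars false

/-! ### Traces in braided categories -/

section Trace

variable {C : Type u} [Category.{v} C] [MonoidalCategory C] [BraidedCategory C]

/-- The trace of an endomorphism computed with a given dual and without a twist. -/
def pairingTrace (X X' : C) [ExactPairing X X'] (f : X ⟶ X) : 𝟙_ C ⟶ 𝟙_ C :=
  η_ X X' ≫ f ▷ X' ≫ (β_ X X').hom ≫ ε_ X X'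

/-- `g` slides through the braiding, turns into its mate at the evaluation, slides back, and returns
to the other side of `f` at the coevaluation. Only naturality is involved, so no twist is needed. -/
theorem pairingTrace_comp_rightDual {A B : C} [HasRightDual A] [HasRightDual B] (f : A ⟶ B)
    (g : B ⟶ A) : pairingTrace A Aᘁ (f ≫ g) = pairingTrace B Bᘁ (g ≫ f) := by
  simp only [pairingTrace, comp_whiskerRight, Category.assoc]
  rw [BraidedCategory.braiding_naturality_left_assoc, ← rightAdjointMate_comp_evaluation,
    ← BraidedCategory.braiding_naturality_right_assoc, ← whisker_exchange_assoc,
    ← Category.assoc, coevaluation_comp_rightAdjointMate, Category.assoc]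

theorem pairingTrace_comp {A A' B B' : C} [ExactPairing A A'] [ExactPairing B B'] (f : A ⟶ B)
    (g : B ⟶ A) : pairingTrace A A' (f ≫ g) = pairingTrace B B' (g ≫ f) :=
  @pairingTrace_comp_rightDual C _ _ _ A B ⟨A'⟩ ⟨B'⟩ f g

theorem pairingTrace_eq {A A' A'' : C} [ExactPairing A A'] [ExactPairing A A''] (f : A ⟶ A) :
    pairingTrace A A' f = pairingTrace A A'' f := by
  have h := @pairingTrace_comp_rightDual C _ _ _ A A ⟨A'⟩ ⟨A''⟩ f (𝟙 A)
  simpa using h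

theorem pairingTrace_zero [Preadditive C] [MonoidalPreadditive C] (A A' : C) [ExactPairing A A'] :
    pairingTrace A A' 0 = 0 := by
  simp [pairingTrace]

/-- An endomorphism of square zero has trace zero. -/
theorem pairingTrace_eq_zero_of_sq [Abelian C] [MonoidalPreadditive C] [RightRigidCategory C]
    {A A' : C} [ExactPairing A A'] (f : A ⟶ A) (hf : f ≫ f = 0) : pairingTrace A A' f = 0 := by
  have h1 : factorThruImage f ≫ image.ι f = f := image.fac f
  have h2 : image.ι f ≫ factorThruImage f = 0 := by
    rw [← cancel_epi (factorThruImage f), ← cancel_mono (image.ι f)]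
    simpa using hf
  -- Cyclicity moves the trace to the image, where the composite taken in the other order is zero.
  rw [← h1, pairingTrace_comp (B' := (image f)ᘁ), h2, pairingTrace_zero]

/-- Naturality pulls the strand `Z` through the cap; symmetry turns the crossing left over into its
inverse. -/
theorem braiding_whiskerRight_comp_cap {X X' Z : C}
    (hs : (β_ X Z).hom ≫ (β_ Z X).hom = 𝟙 _) (e : X ⊗ X' ⟶ 𝟙_ C) :
    (β_ X Z).hom ▷ X' ⊗≫ Z ◁ e ⊗≫ 𝟙 Z = 𝟙 _ ⊗≫ X ◁ (β_ Z X').hom ⊗≫ e ▷ Z ⊗≫ 𝟙 Z := by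
  have h1 := BraidedCategory.braiding_naturality_right Z e
  rw [BraidedCategory.braiding_tensor_right_hom, braiding_tensorUnit_right] at h1
  have h2 : Z ◁ e = (𝟙 _ ⊗≫ (β_ Z X).hom ▷ X' ⊗≫ X ◁ (β_ Z X').hom ⊗≫ e ▷ Z ⊗≫ 𝟙 _) := by
    rw [← cancel_mono ((ρ_ Z).hom ≫ (λ_ Z).inv), h1]
    monoidal
  calc _ = ((β_ X Z).hom ≫ (β_ Z X).hom) ▷ X' ⊗≫ X ◁ (β_ Z X').hom ⊗≫ e ▷ Z ⊗≫ 𝟙 Z := by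
        rw [h2]; monoidal
    _ = _ := by rw [hs]; monoidal

theorem braiding_braiding_comp_cup {Y Y' Z : C} (e : Y' ⊗ Y ⟶ 𝟙_ C) :
    Y' ◁ (β_ Y Z).hom ⊗≫ (β_ Y' Z).hom ▷ Y ⊗≫ Z ◁ e ⊗≫ 𝟙 Z = 𝟙 _ ⊗≫ e ▷ Z ⊗≫ 𝟙 Z := by
  have h1 := BraidedCategory.braiding_naturality_left e Z
  rw [BraidedCategory.braiding_tensor_left_hom, braiding_tensorUnit_left] at h1
  calc _ = 𝟙 _ ⊗≫ ((α_ Y' Y Z).hom ≫ Y' ◁ (β_ Y Z).hom ≫ (α_ Y' Z Y).inv ≫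
        (β_ Y' Z).hom ▷ Y ≫ (α_ Z Y' Y).hom) ≫ Z ◁ e ≫ (ρ_ Z).hom := by monoidal
    _ = 𝟙 _ ⊗≫ (e ▷ Z ≫ (λ_ Z).hom ≫ (ρ_ Z).inv) ≫ (ρ_ Z).hom := by rw [h1]; monoidal
    _ = _ := by monoidal

/-- In a symmetric category, the dimension is multiplicative. -/
theorem pairingTrace_tensor (hs : ∀ X Y : C, (β_ X Y).hom ≫ (β_ Y X).hom = 𝟙 _)
    (X X' Y Y' : C) [ExactPairing X X'] [ExactPairing Y Y'] :
    pairingTrace (X ⊗ Y) (Y' ⊗ X') (𝟙 _) = pairingTrace X X' (𝟙 _) ≫ pairingTrace Y Y' (𝟙 _) := by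
  -- The closure of the `Y` strand is unlinked from that of the `X` strand, leaving nested loops;
  -- this is where symmetry enters.
  have key : (β_ (X ⊗ Y) (Y' ⊗ X')).hom ≫ ε_ (X ⊗ Y) (Y' ⊗ X') =
      𝟙 _ ⊗≫ X ◁ ((β_ Y Y').hom ≫ ε_ Y Y') ▷ X' ⊗≫ (β_ X X').hom ≫ ε_ X X' := by
    rw [ExactPairing.tensor_evaluation]
    set εX := ε_ X X'
    set εY := ε_ Y Y'
    calc
      _ = 𝟙 _ ⊗≫ X ◁ (β_ Y Y').hom ▷ X' ⊗≫ X ◁ Y' ◁ (β_ Y X').hom ⊗≫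
          ((β_ X Y').hom ▷ X' ⊗≫ Y' ◁ ((β_ X X').hom ≫ εX) ⊗≫ 𝟙 Y') ▷ Y ⊗≫ εY := by
        simp only [BraidedCategory.braiding_tensor_left_hom,
          BraidedCategory.braiding_tensor_right_hom]
        trans 𝟙 _ ⊗≫ X ◁ (β_ Y Y').hom ▷ X' ⊗≫ ((β_ X Y').hom ▷ (Y ⊗ X') ≫
          (Y' ⊗ X) ◁ (β_ Y X').hom) ⊗≫ Y' ◁ ((β_ X X').hom ≫ εX) ▷ Y ⊗≫ εY
        · monoidal
        · rw [← whisker_exchange]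
          monoidal
      _ = 𝟙 _ ⊗≫ X ◁ (β_ Y Y').hom ▷ X' ⊗≫ X ◁ Y' ◁ (β_ Y X').hom ⊗≫
          X ◁ (β_ Y' X').hom ▷ Y ⊗≫ (((β_ X X').hom ≫ εX) ▷ (Y' ⊗ Y) ≫ 𝟙_ C ◁ εY) ⊗≫ 𝟙 _ := by
        rw [braiding_whiskerRight_comp_cap (hs _ _)]
        monoidal
      _ = 𝟙 _ ⊗≫ X ◁ (β_ Y Y').hom ▷ X' ⊗≫ X ◁ (Y' ◁ (β_ Y X').hom ⊗≫
          (β_ Y' X').hom ▷ Y ⊗≫ X' ◁ εY ⊗≫ 𝟙 X') ⊗≫ ((β_ X X').hom ≫ εX) := by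
        rw [← whisker_exchange]
        monoidal
      _ = _ := by
        rw [braiding_braiding_comp_cup]
        monoidal
  have h : pairingTrace (X ⊗ Y) (Y' ⊗ X') (𝟙 _) = η_ X X' ⊗≫ X ◁ (η_ Y Y' ≫ (β_ Y Y').hom ≫ ε_ Y Y') ▷ X' ⊗≫
      (β_ X X').hom ≫ ε_ X X' := by
    rw [pairingTrace, id_whiskerRight, Category.id_comp, key, ExactPairing.tensor_coevaluation]
    monoidal
  rw [h]
  simp only [pairingTrace, id_whiskerRight, Category.id_comp]
  set t := η_ Y Y' ≫ (β_ Y Y').hom ≫ ε_ Y Y'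
  set s := (β_ X X').hom ≫ ε_ X X'
  have ht : X ◁ t = 𝟙 _ ⊗≫ t ▷ X ⊗≫ 𝟙 _ := by
    have h1 := BraidedCategory.braiding_naturality_right X t
    rw [braiding_tensorUnit_right] at h1
    rw [← cancel_mono ((ρ_ X).hom ≫ (λ_ X).inv), h1]
    monoidal
  calc
    _ = η_ X X' ⊗≫ (t ▷ (X ⊗ X') ≫ 𝟙_ C ◁ s) ⊗≫ 𝟙 _ := by
      trans η_ X X' ⊗≫ (X ◁ t) ▷ X' ⊗≫ s
      · monoidal
      · rw [ht]
        monoidal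
    _ = _ := by
      rw [← whisker_exchange]
      monoidal

end Trace

/-! ### Fibonacci categories -/

/-- The identity of `Z` is a finite sum of endomorphisms that factor through objects
satisfying `P`. -/
def DecomposesInto {C : Type u} [Category.{v} C] [Preadditive C] (P : C → Prop) (Z : C) : Prop :=
  ∃ (n : ℕ) (V : Fin n → C) (p : ∀ j, Z ⟶ V j) (i : ∀ j, V j ⟶ Z),
    (∀ j, P (V j)) ∧ ∑ j, p j ≫ i j = 𝟙 Z

theorem DecomposesInto.of_iso_biproduct {C : Type u} [Category.{v} C] [Abelian C] {P : C → Prop}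
    {Z : C} {n : ℕ} {S : Fin n → C} (hS : ∀ j, ∃ T, P T ∧ Nonempty (S j ≅ T)) (e : Z ≅ ⨁ S) :
    DecomposesInto P Z := by
  choose T hT f using hS
  refine ⟨n, T, fun j => e.hom ≫ biproduct.π S j ≫ (f j).some.hom,
    fun j => (f j).some.inv ≫ biproduct.ι S j ≫ e.inv, hT, ?_⟩
  have h : ∑ j, biproduct.π S j ≫ biproduct.ι S j = 𝟙 _ := biproduct.total
  have h2 : e.hom ≫ (∑ j, biproduct.π S j ≫ biproduct.ι S j) ≫ e.inv = 𝟙 Z := by simp [h]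
  simp only [Preadditive.sum_comp, Preadditive.comp_sum] at h2
  simpa only [Category.assoc, Iso.hom_inv_id_assoc] using h2

section Fibonacci

variable {k : Type w} [Field k] {F : Type u} [Category.{v} F] [Abelian F]
  [Linear k F] [MonoidalCategory F]

/-- The numerical and splitting data of a nontrivial simple object `X` of a Fibonacci category. -/
structure IsFibonacciObject (k : Type w) [Field k] {F : Type u} [Category.{v} F] [Abelian F]
    [Linear k F] [MonoidalCategory F] (X : F) : Prop where
  end_unit : ∀ f : 𝟙_ F ⟶ 𝟙_ F, ∃ c : k, f = c • 𝟙 _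
  end_self : ∀ f : X ⟶ X, ∃ c : k, f = c • 𝟙 _
  unit_self : ∀ f : 𝟙_ F ⟶ X, f = 0
  self_unit : ∀ f : X ⟶ 𝟙_ F, f = 0
  id_unit_ne : 𝟙 (𝟙_ F) ≠ 0
  id_self_ne : 𝟙 X ≠ 0
  decomposes : ∀ Z : F, DecomposesInto (fun V => V = 𝟙_ F ∨ V = X) Z
  fusion : ∃ (p : X ⊗ X ⟶ 𝟙_ F) (i : 𝟙_ F ⟶ X ⊗ X) (q : X ⊗ X ⟶ X) (j : X ⟶ X ⊗ X),
    i ≫ p = 𝟙 _ ∧ j ≫ q = 𝟙 _ ∧ p ≫ i + q ≫ j = 𝟙 _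

theorem isFibonacciObject_of_simple [IsAlgClosed k] [MonoidalPreadditive F] [MonoidalLinear k F]
    [RigidCategory F] (hF : IsFusion k F) {X : F} (hX : Simple X) (hX1 : ¬ Nonempty (X ≅ 𝟙_ F))
    (hX2 : ∀ Y : F, Simple Y → Nonempty (Y ≅ 𝟙_ F) ∨ Nonempty (Y ≅ X))
    (e : X ⊗ X ≅ 𝟙_ F ⊞ X) : IsFibonacciObject k X := by
  have := hF.finite_hom
  have := hF.simple_unit
  have hX1' : ¬ Nonempty (𝟙_ F ≅ X) := fun ⟨e⟩ => hX1 ⟨e.symm⟩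
  refine ⟨fun f => ?_, fun f => ?_, fun f => ?_, fun f => ?_, id_nonzero _, id_nonzero _,
    fun Z => ?_, ?_⟩
  · obtain ⟨c, hc⟩ := endomorphism_simple_eq_smul_id k f
    exact ⟨c, hc.symm⟩
  · obtain ⟨c, hc⟩ := endomorphism_simple_eq_smul_id k f
    exact ⟨c, hc.symm⟩
  · by_contra h
    exact hX1' ⟨@asIso _ _ _ _ f ((isIso_iff_nonzero f).2 h)⟩
  · by_contra h
    exact hX1 ⟨@asIso _ _ _ _ f ((isIso_iff_nonzero f).2 h)⟩
  · obtain ⟨n, S, hS, ⟨f⟩⟩ := hF.semisimple Z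
    refine DecomposesInto.of_iso_biproduct (S := S) (fun j => ?_) f
    rcases hX2 _ (hS j) with h | h
    · exact ⟨_, Or.inl rfl, h⟩
    · exact ⟨_, Or.inr rfl, h⟩
  · refine ⟨e.hom ≫ biprod.fst, biprod.inl ≫ e.inv, e.hom ≫ biprod.snd, biprod.inr ≫ e.inv,
      by simp, by simp, ?_⟩
    have h2 : e.hom ≫ (biprod.fst ≫ biprod.inl + biprod.snd ≫ biprod.inr) ≫ e.inv = 𝟙 _ := by
      rw [biprod.total]; simp
    simpa only [Preadditive.comp_add, Preadditive.add_comp, Category.assoc] using h2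

namespace IsFibonacciObject

variable {X : F} (h : IsFibonacciObject k X)
include h

/-- The nontrivial simple object of a Fibonacci category is self-dual. -/
theorem nonempty_exactPairing [MonoidalPreadditive F] [MonoidalLinear k F]
    [RigidCategory F] : Nonempty (ExactPairing X X) := by
  obtain ⟨p, i, q, j, hip, hjq, hpq⟩ := h.fusion
  have hz : ∀ f : Xᘁ ⟶ 𝟙_ F, f = 0 := fun f => by
    have h1 : tensorLeftHomEquiv (𝟙_ F) X Xᘁ (𝟙_ F) ((ρ_ _).hom ≫ f) = 0 := by
      rw [← cancel_mono (ρ_ X).hom, h.unit_self (_ ≫ (ρ_ X).hom), zero_comp]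
    have h2 : (ρ_ _).hom ≫ f = 0 := by
      apply (tensorLeftHomEquiv (𝟙_ F) X Xᘁ (𝟙_ F)).injective
      rw [h1]
      simp [tensorLeftHomEquiv]
    rw [← cancel_epi (ρ_ (Xᘁ)).hom, h2, comp_zero]
  -- The adjoint of `i : 𝟙 ⟶ X ⊗ X`. It spans `Hom(Xᘁ, X)`, and `Hom(Xᘁ, 𝟙) = 0`, so the identity of
  -- `Xᘁ` factors through `r`.
  let r : Xᘁ ⟶ X := (ρ_ _).inv ≫ (tensorLeftHomEquiv (𝟙_ F) X Xᘁ X).symm i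
  have hr : ∀ f : Xᘁ ⟶ X, ∃ c : k, f = c • r := fun f => by
    set g := tensorLeftHomEquiv (𝟙_ F) X Xᘁ X ((ρ_ _).hom ≫ f) with hg
    obtain ⟨c, hc⟩ := h.end_unit (g ≫ p)
    have h1 : g = c • i := by
      rw [← Category.comp_id g, ← hpq, Preadditive.comp_add, ← Category.assoc, hc,
        ← Category.assoc g q, h.unit_self (g ≫ q)]
      simp
    have h2 : (ρ_ _).hom ≫ f = (tensorLeftHomEquiv (𝟙_ F) X Xᘁ X).symm (c • i) := by
      rw [← h1, hg, Equiv.symm_apply_apply]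
    refine ⟨c, ?_⟩
    rw [← cancel_epi (ρ_ (Xᘁ)).hom, h2]
    simp [r, tensorLeftHomEquiv]
  obtain ⟨n, V, a, b, hV, hab⟩ := h.decomposes (Xᘁ)
  have hs : ∃ s : X ⟶ Xᘁ, r ≫ s = 𝟙 _ := by
    have : ∀ j, ∃ s : X ⟶ Xᘁ, a j ≫ b j = r ≫ s := fun j => by
      rcases hV j with hj | hj
      · generalize a j = a', b j = b' at *
        revert a' b'
        rw [hj]
        intro a' b'
        exact ⟨0, by rw [hz a']; simp⟩
      · generalize a j = a', b j = b' at *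
        revert a' b'
        rw [hj]
        intro a' b'
        obtain ⟨c, hc⟩ := hr a'
        exact ⟨c • b', by rw [hc]; simp⟩
    choose s hs using this
    exact ⟨∑ j, s j, by rw [Preadditive.comp_sum, ← hab]; simp [hs]⟩
  obtain ⟨s, hs⟩ := hs
  obtain ⟨c, hc⟩ := h.end_self (s ≫ r)
  have hid : 𝟙 (Xᘁ) ≠ 0 := fun h0 => h.id_self_ne <| by
    have h1 : ε_ X Xᘁ = 0 := by
      rw [← Category.id_comp (ε_ X Xᘁ), ← id_whiskerRight, h0]
      simp
    have h2 := ExactPairing.evaluation_coevaluation X Xᘁ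
    rw [h1] at h2
    rw [← cancel_epi (λ_ X).hom, ← cancel_mono (ρ_ X).inv, Category.comp_id, ← h2]
    simp
  have hc1 : c = 1 := by
    have h1 : (c - 1) • s = 0 := by
      have : s ≫ r ≫ s = c • s := by rw [← Category.assoc, hc]; simp
      rw [hs, Category.comp_id] at this
      rw [sub_smul, one_smul, ← this, sub_self]
    rcases smul_eq_zero.1 h1 with h2 | h2
    · exact sub_eq_zero.1 h2
    · exact absurd (by rw [← hs, h2, comp_zero]) hid
  let e : X ≅ Xᘁ := ⟨s, r, by rw [hc, hc1, one_smul], hs⟩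
  exact ⟨exactPairingCongrRight e⟩

end IsFibonacciObject
end Fibonacci

/-! ### Twists and traces in a ribbon category. -/

section RibbonGeneral

variable {C : Type u} [Category.{v} C] [MonoidalCategory C] [BraidedCategory C] [RigidCategory C]
  [RibbonTwist C]

theorem ribbonTwist_naturality {X Y : C} (f : X ⟶ Y) : f ≫ ribbonTwist Y = ribbonTwist X ≫ f :=
  RibbonTwist.twist_naturality f

theorem ribbonTwist_tensor (X Y : C) : ribbonTwist (X ⊗ Y) =
    (ribbonTwist X ⊗ₘ ribbonTwist Y) ≫ (β_ X Y).hom ≫ (β_ Y X).hom :=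
  RibbonTwist.twist_tensor X Y

instance (X : C) : IsIso (ribbonTwist X) := inferInstanceAs (IsIso (RibbonTwist.twist X).hom)

/-- Balancing on `𝟙 ⊗ 𝟙`, where the braiding is trivial, makes the invertible `θ_𝟙` equal to its own
square. -/
theorem ribbonTwist_unit : ribbonTwist (𝟙_ C) = 𝟙 _ := by
  have h := ribbonTwist_tensor (𝟙_ C) (𝟙_ C)
  have h1 : (β_ (𝟙_ C) (𝟙_ C)).hom = 𝟙 _ := by
    rw [braiding_tensorUnit_left, unitors_equal, Iso.hom_inv_id]
  rw [h1, Category.comp_id, Category.comp_id] at h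
  have h2 := ribbonTwist_naturality (λ_ (𝟙_ C)).hom
  rw [h, tensorHom_def', Category.assoc] at h2
  have h3 : (ribbonTwist (𝟙_ C)) ▷ 𝟙_ C ≫ (λ_ (𝟙_ C)).hom =
      (λ_ (𝟙_ C)).hom ≫ ribbonTwist (𝟙_ C) := by
    rw [unitors_equal]; simp
  rw [h3, leftUnitor_naturality_assoc, cancel_epi] at h2
  rw [← cancel_epi (ribbonTwist (𝟙_ C)), ← h2, Category.comp_id]

theorem ribbonTrace_id_eq_pairingTrace {X : C} (hX : ribbonTwist X = 𝟙 X) (f : X ⟶ X) :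
    ribbonTrace f = pairingTrace X Xᘁ f := by
  rw [ribbonTrace, hX, Category.comp_id, pairingTrace]

end RibbonGeneral

/-! ### The twist of the Fibonacci object. -/

section Fibonacci

variable {k : Type w} [Field k] {F : Type u} [Category.{v} F] [Abelian F]
  [Linear k F] [MonoidalCategory F] [MonoidalPreadditive F] [MonoidalLinear k F]
  [BraidedCategory F] [RigidCategory F] [RibbonTwist F]

namespace IsFibonacciObject

variable {X : F} (h : IsFibonacciObject k X)
include h

theorem ribbonTwist_eq_id (hX : ribbonTwist X = 𝟙 X) (Z : F) : ribbonTwist Z = 𝟙 Z := by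
  obtain ⟨n, V, p, i, hV, hpi⟩ := h.decomposes Z
  have hV' : ∀ j, ribbonTwist (V j) = 𝟙 (V j) := fun j => by
    rcases hV j with hj | hj
    · rw [hj, ribbonTwist_unit]
    · rw [hj, hX]
  rw [← Category.id_comp (ribbonTwist Z), ← hpi, Preadditive.sum_comp]
  refine Finset.sum_congr rfl fun j _ => ?_
  rw [Category.assoc, ribbonTwist_naturality, hV', Category.id_comp]

/-- If `θ_X = 1`, every twist is trivial, so balancing makes every double braiding trivial. The
entries of the trace matrix are then products of dimensions, contradicting non-degeneracy. -/
theorem ribbonTwist_ne_id (hF : IsModular k F)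
    (hsimp : IsSimpleList ![𝟙_ F, X]) : ribbonTwist X ≠ 𝟙 X := fun hX => by
  have hid := h.ribbonTwist_eq_id hX
  have hs : ∀ Y Z : F, (β_ Y Z).hom ≫ (β_ Z Y).hom = 𝟙 _ := fun Y Z => by
    have := ribbonTwist_tensor Y Z
    rw [hid, hid, hid] at this
    simpa using this.symm
  have hmul : ∀ Y Z : F, ribbonTrace ((β_ Y Z).hom ≫ (β_ Z Y).hom) =
      ribbonTrace (𝟙 Y) ≫ ribbonTrace (𝟙 Z) := fun Y Z => by
    rw [hs, ribbonTrace_id_eq_pairingTrace (hid _), ribbonTrace_id_eq_pairingTrace (hid _),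
      ribbonTrace_id_eq_pairingTrace (hid _), ← pairingTrace_tensor hs]
    apply pairingTrace_eq
  obtain ⟨a, ha⟩ := h.end_unit (ribbonTrace (𝟙 (𝟙_ F)))
  obtain ⟨b, hb⟩ := h.end_unit (ribbonTrace (𝟙 X))
  have key : ∀ x y : k, x * a + y * b = 0 → x = 0 ∧ y = 0 := fun x y hxy => by
    have := hF.nondegenerate 2 ![𝟙_ F, X] hsimp ![x, y] (fun i => by
      rw [Fin.sum_univ_two, hmul, hmul, ← Linear.smul_comp, ← Linear.smul_comp,
        ← Preadditive.add_comp]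
      simp only [Matrix.cons_val_zero, Matrix.cons_val_one, ha, hb]
      rw [smul_smul, smul_smul, ← add_smul, hxy, zero_smul, zero_comp])
    exact ⟨congrFun this 0, congrFun this 1⟩
  -- The vector `(b, -a)` is in the kernel, so both dimensions vanish; then `(1, 0)` is in the
  -- kernel too.
  obtain ⟨h1, h2⟩ := key b (-a) (by ring)
  have h3 := key 1 0 (by rw [neg_eq_zero.1 h2, h1]; ring)
  exact one_ne_zero h3.1

theorem exists_braiding_eigenvalue {p : X ⊗ X ⟶ 𝟙_ F} {i : 𝟙_ F ⟶ X ⊗ X} {q : X ⊗ X ⟶ X}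
    {j : X ⟶ X ⊗ X} (hpq : p ≫ i + q ≫ j = 𝟙 _) : ∃ c : k, (β_ X X).hom ≫ p = c • p := by
  obtain ⟨c, hc⟩ := h.end_unit (i ≫ (β_ X X).hom ≫ p)
  refine ⟨c, ?_⟩
  rw [← Category.id_comp ((β_ X X).hom ≫ p), ← hpq, Preadditive.add_comp, Category.assoc, hc,
    Category.assoc q j, h.self_unit (j ≫ _)]
  simp

/-- A basis of `Hom (X ⊗ X ⊗ X, X)`. -/
theorem exists_basis {p : X ⊗ X ⟶ 𝟙_ F} {i : 𝟙_ F ⟶ X ⊗ X} {q : X ⊗ X ⟶ X} {j : X ⟶ X ⊗ X}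
    (hip : i ≫ p = 𝟙 _) (hjq : j ≫ q = 𝟙 _) (hpq : p ≫ i + q ≫ j = 𝟙 _) :
    ∃ b : Module.Basis (Fin 2) k (X ⊗ (X ⊗ X) ⟶ X),
      ⇑b = ![X ◁ p ≫ (ρ_ X).hom, X ◁ q ≫ q] := by
  have hiq : i ≫ q = 0 := h.unit_self _
  have hjp : j ≫ p = 0 := h.self_unit _
  have hli : LinearIndependent k ![X ◁ p ≫ (ρ_ X).hom, X ◁ q ≫ q] := by
    rw [LinearIndependent.pair_iff]
    intro s t hst
    -- Restriction along the inclusions `i` and `j` isolates the two coefficients.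
    have h1 := congrArg (fun f => (ρ_ X).inv ≫ X ◁ i ≫ f) hst
    have h2 := congrArg (fun f => j ≫ X ◁ j ≫ f) hst
    simp only [Preadditive.comp_add, Linear.comp_smul, ← whiskerLeft_comp_assoc, hip, hjq, hiq,
      hjp, MonoidalCategory.whiskerLeft_id, Category.id_comp, Iso.inv_hom_id, comp_zero, MonoidalPreadditive.whiskerLeft_zero, zero_comp, smul_zero,
      add_zero, zero_add] at h1 h2
    exact ⟨(smul_eq_zero.1 h1).resolve_right h.id_self_ne,
      (smul_eq_zero.1 h2).resolve_right h.id_self_ne⟩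
  have hsp : ⊤ ≤ Submodule.span k (Set.range ![X ◁ p ≫ (ρ_ X).hom, X ◁ q ≫ q]) := by
    intro f _
    obtain ⟨c, hc⟩ := h.end_self ((ρ_ X).inv ≫ X ◁ i ≫ f)
    obtain ⟨d, hd⟩ := h.end_self (j ≫ X ◁ j ≫ f)
    have h1 : X ◁ i ≫ f = c • (ρ_ X).hom := by
      rw [← cancel_epi (ρ_ X).inv, hc]; simp
    have h2 : X ◁ j ≫ f = d • q := by
      rw [← Category.id_comp (X ◁ j ≫ f), ← hpq, Preadditive.add_comp, Category.assoc,
        Category.assoc, hd, h.unit_self (i ≫ _)]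
      simp
    have h3 : f = c • (X ◁ p ≫ (ρ_ X).hom) + d • (X ◁ q ≫ q) := by
      rw [← Linear.comp_smul, ← Linear.comp_smul, ← h1, ← h2, ← Category.assoc, ← Category.assoc,
        ← Preadditive.add_comp, ← whiskerLeft_comp, ← whiskerLeft_comp, ← MonoidalPreadditive.whiskerLeft_add, hpq]
      simp
    rw [h3]
    refine add_mem (Submodule.smul_mem _ _ (Submodule.subset_span ⟨0, rfl⟩))
      (Submodule.smul_mem _ _ (Submodule.subset_span ⟨1, rfl⟩))
  exact ⟨Module.Basis.mk hli hsp, by simp⟩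

/-- If `θ = -1`, the double braiding has eigenvalue 1 on `𝟙` and -1 on `X` inside `X ⊗ X`, so `c² =
1` and `u² = -1`. Let `cu` and `d` be the determinants of the two braid generators on the plane
`Hom(X ⊗ X ⊗ X, X)`. The full twist gives `d² = 1`; the Yang-Baxter relation then gives `cu = d(cu)²
= -d`, so `(cu)² = 1`, against `(cu)² = -1`. -/
theorem twist_sq_ne_one [CharZero k] {u θ : k} (hu : ∀ f : X ⊗ X ⟶ X, (β_ X X).hom ≫ f = u • f)
    (hθ : ribbonTwist X = θ • 𝟙 X) (hθ1 : θ ≠ 1) : θ ^ 2 ≠ 1 := fun hsq => by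
  have hθm : θ = -1 := (sq_eq_one_iff.1 hsq).resolve_left hθ1
  obtain ⟨p, i, q, j, hip, hjq, hpq⟩ := h.fusion
  obtain ⟨c, hc⟩ := h.exists_braiding_eigenvalue hpq
  have htw : ribbonTwist (X ⊗ X) = (β_ X X).hom ≫ (β_ X X).hom := by
    rw [ribbonTwist_tensor, hθ, hθm, MonoidalCategory.tensorHom_def,
      MonoidalLinear.smul_whiskerRight, MonoidalLinear.whiskerLeft_smul]
    simp
  have hc2 : c ^ 2 = 1 := by
    have h1 := ribbonTwist_naturality p
    rw [ribbonTwist_unit, htw, Category.assoc, hc, Linear.comp_smul, hc, smul_smul] at h1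
    have h2 := congrArg (fun f => i ≫ f) h1
    simp only [Linear.comp_smul, hip, Category.comp_id] at h2
    have h3 : (c ^ 2 - 1) • 𝟙 (𝟙_ F) = 0 := by rw [sub_smul, sq, ← h2]; simp
    exact sub_eq_zero.1 ((smul_eq_zero.1 h3).resolve_right h.id_unit_ne)
  have hu2 : u ^ 2 = -1 := by
    have h1 := ribbonTwist_naturality q
    rw [hθ, htw, Category.assoc, hu, Linear.comp_smul, hu, smul_smul, hθm] at h1
    have h2 := congrArg (fun f => j ≫ f) h1
    simp only [Linear.comp_smul, hjq, Category.comp_id] at h2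
    have h3 : (u ^ 2 - (-1)) • 𝟙 X = 0 := by rw [sub_smul, sq, ← h2]; simp
    exact sub_eq_zero.1 ((smul_eq_zero.1 h3).resolve_right h.id_self_ne)
  obtain ⟨b, hb⟩ := h.exists_basis hip hjq hpq
  let L : (X ⊗ (X ⊗ X) ⟶ X ⊗ (X ⊗ X)) → Module.End k (X ⊗ (X ⊗ X) ⟶ X) :=
    fun f => Linear.leftComp k X f
  have hL : ∀ f g, LinearMap.det (L (f ≫ g)) = LinearMap.det (L f) * LinearMap.det (L g) := by
    intro f g
    rw [← LinearMap.det_comp]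
    congr 1
    ext x
    simp [L]
  have h2 : LinearMap.det (L (X ◁ (β_ X X).hom)) = c * u := by
    have : LinearMap.toMatrix b b (L (X ◁ (β_ X X).hom)) = Matrix.diagonal ![c, u] := by
      rw [← LinearEquiv.eq_symm_apply, LinearMap.toMatrix_symm]
      refine b.ext fun n => ?_
      rw [Matrix.toLin_self]
      fin_cases n
      · simp [hb, L, ← whiskerLeft_comp_assoc, hc]
      · simp [hb, L, ← whiskerLeft_comp_assoc, hu]
    rw [← LinearMap.det_toMatrix b, this]
    simp
  set s1 : X ⊗ (X ⊗ X) ⟶ X ⊗ (X ⊗ X) := (α_ X X X).inv ≫ (β_ X X).hom ▷ X ≫ (α_ X X X).hom with hs1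
  have hyb : s1 ≫ X ◁ (β_ X X).hom ≫ s1 = X ◁ (β_ X X).hom ≫ s1 ≫ X ◁ (β_ X X).hom := by
    simpa [s1] using BraidedCategory.yang_baxter X X X
  -- The factor `-1` is the twist of the first `X`; the first two crossings are the twist of the
  -- remaining `X ⊗ X`.
  have hfull : ribbonTwist (X ⊗ (X ⊗ X)) = (-1 : k) • (X ◁ (β_ X X).hom ≫ X ◁ (β_ X X).hom ≫ s1 ≫
      X ◁ (β_ X X).hom ≫ X ◁ (β_ X X).hom ≫ s1) := by
    rw [ribbonTwist_tensor, htw, hθ, hθm, BraidedCategory.braiding_tensor_left_hom,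
      BraidedCategory.braiding_tensor_right_hom, MonoidalCategory.tensorHom_def,
      MonoidalLinear.smul_whiskerRight]
    simp [s1]
  set d := LinearMap.det (L s1)
  have hfin : Module.finrank k (X ⊗ (X ⊗ X) ⟶ X) = 2 := by
    rw [Module.finrank_eq_card_basis b]; simp
  have hdet : LinearMap.det (L (ribbonTwist (X ⊗ (X ⊗ X)))) = 1 := by
    -- Naturality moves the twist to the target `X`. The sign disappears from the determinant
    -- because the space has dimension 2.
    have : L (ribbonTwist (X ⊗ (X ⊗ X))) = (-1 : k) • LinearMap.id := by
      ext f
      simp only [L, Linear.leftComp_apply]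
      rw [← ribbonTwist_naturality, hθ, hθm]
      simp
    rw [this, LinearMap.det_smul, hfin]
    simp
  have hdet2 : LinearMap.det (L (ribbonTwist (X ⊗ (X ⊗ X)))) = (c * u) * ((c * u) * (d *
      ((c * u) * ((c * u) * d)))) := by
    have : ∀ f, L ((-1 : k) • f) = (-1 : k) • L f := fun f => by ext x; simp [L]
    rw [hfull, this, LinearMap.det_smul, hfin]
    simp only [hL, h2]
    simp [d]
  have hdd := congrArg (fun f => LinearMap.det (L f)) hyb
  simp only [hL, h2] at hdd
  have hcu : (c * u) ^ 2 = -1 := by rw [mul_pow, hc2, hu2]; ring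
  have e1 : d ^ 2 = 1 := by
    have : d ^ 2 * ((c * u) ^ 2) ^ 2 = 1 := by rw [← hdet, hdet2]; ring
    rw [hcu] at this
    simpa using this
  have e2 : c * u = d * (c * u) ^ 2 := by
    have : d ^ 2 * (c * u) = d * (c * u) ^ 2 := by
      linear_combination hdd
    rw [← this, e1, one_mul]
  rw [hcu] at e2
  have e3 : (c * u) ^ 2 = 1 := by rw [e2]; linear_combination e1
  rw [hcu] at e3
  exact absurd e3 (by norm_num)

end IsFibonacciObject

theorem IsFibonacci.exists_fibonacciObject [IsAlgClosed k] [CharZero k] {u : k}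
    (hF : IsFibonacci k F u) : ∃ (X : F) (θ : k), IsFibonacciObject k X ∧
      ribbonTwist X = θ • 𝟙 X ∧ θ ≠ 1 ∧ θ ^ 2 ≠ 1 := by
  obtain ⟨X, hX, hX1, hX2, ⟨e⟩, hu⟩ := hF.fibonacci
  have h := isFibonacciObject_of_simple hF.toIsFusion hX hX1 hX2 e
  obtain ⟨θ, hθ⟩ := h.end_self (ribbonTwist X)
  have hl : IsSimpleList ![𝟙_ F, X] := by
    refine ⟨fun i => ?_, fun i j hij => ?_, fun Y hY => ?_⟩
    · fin_cases i
      · exact hF.simple_unit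
      · exact hX
    · fin_cases i <;> fin_cases j
      · rfl
      · exact absurd (hij.map Iso.symm) hX1
      · exact absurd hij hX1
      · rfl
    · rcases hX2 Y hY with h | h
      · exact ⟨0, h⟩
      · exact ⟨1, h⟩
  have hθ1 : θ ≠ 1 := fun h1 => h.ribbonTwist_ne_id hF.toIsModular hl (by rw [hθ, h1, one_smul])
  exact ⟨X, θ, h, hθ, hθ1, h.twist_sq_ne_one hu hθ hθ1⟩

end Fibonacci

/-! ### Deligne powers of Fibonacci categories -/

section Decompose

variable {C : Type u} [Category.{v} C] [Preadditive C] {P Q : C → Prop}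

theorem DecomposesInto.of_fintype {ι : Type*} [Fintype ι] {Z : C} (V : ι → C) (p : ∀ j, Z ⟶ V j)
    (i : ∀ j, V j ⟶ Z) (hV : ∀ j, P (V j)) (h : ∑ j, p j ≫ i j = 𝟙 Z) : DecomposesInto P Z := by
  let e := Fintype.equivFin ι
  refine ⟨Fintype.card ι, fun j => V (e.symm j), fun j => p (e.symm j), fun j => i (e.symm j),
    fun j => hV _, ?_⟩
  rw [← h]
  exact Equiv.sum_comp e.symm (fun j => p j ≫ i j)

theorem DecomposesInto.trans {Z : C} (h : DecomposesInto P Z)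
    (hPQ : ∀ V, P V → DecomposesInto Q V) : DecomposesInto Q Z := by
  obtain ⟨n, V, p, i, hV, hpi⟩ := h
  choose m W q j hW hqj using fun a => hPQ (V a) (hV a)
  refine DecomposesInto.of_fintype (ι := Σ a, Fin (m a)) (fun x => W x.1 x.2)
    (fun x => p x.1 ≫ q x.1 x.2) (fun x => j x.1 x.2 ≫ i x.1) (fun x => hW _ _) ?_
  rw [Fintype.sum_sigma, ← hpi]
  refine Finset.sum_congr rfl fun a _ => ?_
  have : p a ≫ i a = p a ≫ (∑ b, q a b ≫ j a b) ≫ i a := by rw [hqj, Category.id_comp]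
  rw [this]
  simp [Preadditive.sum_comp, Preadditive.comp_sum]

theorem DecomposesInto.of_iso {Z W : C} (e : Z ≅ W) (hW : P W) : DecomposesInto P Z :=
  DecomposesInto.of_fintype (ι := Unit) (fun _ => W) (fun _ => e.hom) (fun _ => e.inv)
    (fun _ => hW) (by simp)

theorem DecomposesInto.finite_hom (k : Type w) [Field k] [Linear k C] {V W : C}
    (hV : DecomposesInto P V) (hW : DecomposesInto Q W)
    (h : ∀ V W, P V → Q W → Module.Finite k (V ⟶ W)) : Module.Finite k (V ⟶ W) := by
  obtain ⟨n, V', p, i, hV, hpi⟩ := hV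
  obtain ⟨m, W', q, j, hW, hqj⟩ := hW
  have := fun a b => h _ _ (hV a) (hW b)
  let φ : (V ⟶ W) →ₗ[k] ((a : Fin n) → (b : Fin m) → (V' a ⟶ W' b)) :=
    { toFun := fun f a b => i a ≫ f ≫ q b
      map_add' := fun f g => by ext; simp
      map_smul' := fun c f => by ext; simp }
  refine Module.Finite.of_injective φ ((injective_iff_map_eq_zero φ).2 fun f hf => ?_)
  have hf' : ∀ a b, i a ≫ f ≫ q b = 0 := fun a b => congrFun (congrFun hf a) b
  rw [← Category.id_comp f, ← Category.comp_id f, ← hpi, ← hqj, Preadditive.sum_comp]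
  refine Finset.sum_eq_zero fun a _ => ?_
  simp only [Preadditive.comp_sum, Category.assoc]
  refine Finset.sum_eq_zero fun b _ => ?_
  rw [reassoc_of% hf']
  simp

end Decompose

/-- A strong monoidal functor preserves exact pairings. -/
theorem nonempty_exactPairing_map {C : Type*} {D : Type*} [Category* C] [Category* D]
    [MonoidalCategory C] [MonoidalCategory D] (F : C ⥤ D) [F.Monoidal] (X Y : C)
    [ExactPairing X Y] : Nonempty (ExactPairing (F.obj X) (F.obj Y)) := by
  have h1 := congrArg F.map (ExactPairing.evaluation_coevaluation X Y)
  have h2 := congrArg F.map (ExactPairing.coevaluation_evaluation X Y)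
  refine ⟨⟨Functor.LaxMonoidal.ε F ≫ F.map (η_ X Y) ≫ Functor.OplaxMonoidal.δ F X Y,
    Functor.LaxMonoidal.μ F Y X ≫ F.map (ε_ X Y) ≫ Functor.OplaxMonoidal.η F, ?_, ?_⟩⟩
  · simp only [Functor.map_comp, Functor.Monoidal.map_whiskerLeft,
      Functor.Monoidal.map_whiskerRight, Functor.Monoidal.map_associator_inv,
      Functor.Monoidal.map_rightUnitor, Functor.Monoidal.map_leftUnitor_inv, Category.assoc] at h2
    have h3 := congrArg (fun f => (F.obj Y ◁ Functor.LaxMonoidal.ε F ≫ Functor.LaxMonoidal.μ F _ _) ≫ f ≫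
      Functor.OplaxMonoidal.δ F _ _ ≫ Functor.OplaxMonoidal.η F ▷ F.obj Y) h2
    simp only [Category.assoc, Functor.Monoidal.μ_δ_assoc,
      Functor.Monoidal.whiskerLeft_ε_η_assoc, Functor.Monoidal.whiskerRight_ε_η] at h3
    simpa only [MonoidalCategory.whiskerLeft_comp, comp_whiskerRight, Category.assoc,
      Category.comp_id] using h3
  · simp only [Functor.map_comp, Functor.Monoidal.map_whiskerLeft,
      Functor.Monoidal.map_whiskerRight, Functor.Monoidal.map_associator,
      Functor.Monoidal.map_leftUnitor, Functor.Monoidal.map_rightUnitor_inv, Category.assoc] at h1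
    have h3 := congrArg (fun f => (Functor.LaxMonoidal.ε F ▷ F.obj X ≫ Functor.LaxMonoidal.μ F _ _) ≫ f ≫
      Functor.OplaxMonoidal.δ F _ _ ≫ F.obj X ◁ Functor.OplaxMonoidal.η F) h1
    simp only [Category.assoc, Functor.Monoidal.μ_δ_assoc,
      Functor.Monoidal.whiskerRight_ε_η_assoc, Functor.Monoidal.whiskerLeft_ε_η] at h3
    simpa only [MonoidalCategory.whiskerLeft_comp, comp_whiskerRight, Category.assoc,
      Category.comp_id] using h3

/-- Additivity in one coordinate in a form free of `Function.update`; it transports the Fibonacci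
splitting from coordinate `b` to the Deligne power. -/
theorem MultilinearMap.map_add_of_eq_off {R ι : Type*} {M : ι → Type*} {N : Type*} [Semiring R]
    [∀ i, AddCommMonoid (M i)] [AddCommMonoid N] [∀ i, Module R (M i)] [Module R N]
    (m : MultilinearMap R M N) (b : ι) (f g h : ∀ i, M i) (hf : ∀ i, i ≠ b → f i = h i)
    (hg : ∀ i, i ≠ b → g i = h i) (hb : f b + g b = h b) : m f + m g = m h := by
  classical
  have e : ∀ f' : ∀ i, M i, (∀ i, i ≠ b → f' i = h i) → f' = Function.update h b (f' b) := by
    intro f' hf'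
    funext i
    by_cases hi : i = b
    · subst hi; simp
    · simp [hi, hf' i hi]
  rw [e f hf, e g hg, ← m.map_update_add, hb, Function.update_eq_self]

theorem Pi.nonempty_exactPairing {ι : Type*} {C : ι → Type*} [∀ i, Category* (C i)]
    [∀ i, MonoidalCategory (C i)] (X Y : ∀ i, C i) (h : ∀ i, Nonempty (ExactPairing (X i) (Y i))) :
    Nonempty (ExactPairing X Y) := by
  let := fun i => (h i).some
  exact ⟨⟨fun i => η_ (X i) (Y i), fun i => ε_ (X i) (Y i),
    funext fun i => ExactPairing.coevaluation_evaluation _ _,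
    funext fun i => ExactPairing.evaluation_coevaluation _ _⟩⟩

/-- The tensor product of the objects `X b` along a word. -/
def wordObj {ι : Type*} {D : Type u} [Category.{v} D] [MonoidalCategory D] (X : ι → D) :
    List ι → D
  | [] => 𝟙_ D
  | b :: w => X b ⊗ wordObj X w

/-- The properties of the generators `X b` of a Deligne power of a Fibonacci category. -/
structure IsFibonacciFamily (k : Type w) [Field k] {ι : Type} {D : Type u} [Category.{v} D]
    [Abelian D] [Linear k D] [MonoidalCategory D] [BraidedCategory D] [RigidCategory D]
    [RibbonTwist D] (X : ι → D) : Prop where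
  fusion : ∀ b, ∃ (p : X b ⊗ X b ⟶ 𝟙_ D) (i : 𝟙_ D ⟶ X b ⊗ X b) (q : X b ⊗ X b ⟶ X b)
    (j : X b ⟶ X b ⊗ X b), i ≫ p = 𝟙 _ ∧ j ≫ q = 𝟙 _ ∧ p ≫ i + q ≫ j = 𝟙 _
  self_dual : ∀ b, Nonempty (ExactPairing (X b) (X b))
  decomposes : ∀ Z : D, DecomposesInto (fun V => ∃ w : List ι, w.Nodup ∧ V = wordObj X w) Z
  split : ∀ (w w' : List ι), w.Nodup → w'.Nodup → ∀ f : wordObj X w ⟶ wordObj X w', f ≠ 0 →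
    ∃ g, g ≫ f = 𝟙 _
  end_unit : ∀ f : 𝟙_ D ⟶ 𝟙_ D, ∃ c : k, f = c • 𝟙 _
  finite_hom : ∀ V W : D, Module.Finite k (V ⟶ W)
  twist : ∀ w : List ι, w.Nodup → w.length = 1 ∨ w.length = 2 →
    ∃ c : k, c ≠ 1 ∧ ribbonTwist (wordObj X w) = c • 𝟙 _

/-! ### Subset-labelled objects of the Deligne power. -/

section Label

variable {k : Type w} [Field k] {F : Type u} [Category.{v} F] [Abelian F]
  [Linear k F] [MonoidalCategory F]

open Classical in
/-- The family of objects which is `X` on `s` and the unit elsewhere. -/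
noncomputable def labelObj {l : ℕ} (X : F) (s : Finset (Fin l)) : Fin l → F :=
  fun i => if i ∈ s then X else 𝟙_ F

theorem labelObj_of_mem {l : ℕ} (X : F) {s : Finset (Fin l)} {i : Fin l} (h : i ∈ s) :
    labelObj X s i = X := if_pos h

theorem labelObj_of_notMem {l : ℕ} (X : F) {s : Finset (Fin l)} {i : Fin l} (h : i ∉ s) :
    labelObj X s i = 𝟙_ F := if_neg h

theorem nonempty_labelObj_empty_iso {l : ℕ} (X : F) :
    Nonempty (labelObj X (∅ : Finset (Fin l)) ≅ 𝟙_ (Fin l → F)) := by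
  have : labelObj X (∅ : Finset (Fin l)) = 𝟙_ (Fin l → F) :=
    funext fun i => labelObj_of_notMem X (Finset.notMem_empty i)
  exact ⟨eqToIso this⟩

theorem nonempty_labelObj_insert_iso {l : ℕ} (X : F) {b : Fin l} {s : Finset (Fin l)}
    (hb : b ∉ s) : Nonempty (labelObj X {b} ⊗ labelObj X s ≅ labelObj X (insert b s)) := by
  have : ∀ i, Nonempty (labelObj X {b} i ⊗ labelObj X s i ≅ labelObj X (insert b s) i) := by
    intro i
    by_cases hi : i = b
    · subst hi
      rw [labelObj_of_mem X (Finset.mem_singleton_self i), labelObj_of_notMem X hb,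
        labelObj_of_mem X (Finset.mem_insert_self i s)]
      exact ⟨ρ_ X⟩
    · rw [labelObj_of_notMem X (by simpa using hi)]
      by_cases hs : i ∈ s
      · rw [labelObj_of_mem X hs, labelObj_of_mem X (by simp [hs])]
        exact ⟨λ_ X⟩
      · rw [labelObj_of_notMem X hs, labelObj_of_notMem X (by simp [hs, hi])]
        exact ⟨λ_ _⟩
  exact ⟨Pi.isoMk fun i => (this i).some⟩

theorem IsFibonacciObject.hom_labelObj {X : F} (h : IsFibonacciObject k X) {l : ℕ}
    {s : Finset (Fin l)} {i : Fin l} (f : labelObj X s i ⟶ labelObj X s i) :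
    ∃ c : k, f = c • 𝟙 _ := by
  by_cases hi : i ∈ s
  · revert f
    rw [labelObj_of_mem X hi]
    exact h.end_self
  · revert f
    rw [labelObj_of_notMem X hi]
    exact h.end_unit

theorem IsFibonacciObject.hom_labelObj_eq_zero {X : F} (h : IsFibonacciObject k X) {l : ℕ}
    {s t : Finset (Fin l)} {i : Fin l} (hst : ¬ (i ∈ s ↔ i ∈ t))
    (f : labelObj X s i ⟶ labelObj X t i) : f = 0 := by
  revert f
  by_cases hi : i ∈ s
  · rw [labelObj_of_mem X hi, labelObj_of_notMem X (by tauto)]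
    exact h.self_unit
  · rw [labelObj_of_notMem X hi, labelObj_of_mem X (by tauto)]
    exact h.unit_self

/-- The componentwise splitting of `labelObj X {b} ⊗ labelObj X {b}`. -/
theorem IsFibonacciObject.exists_splitting {X : F} (h : IsFibonacciObject k X) {l : ℕ}
    (b i : Fin l) :
    ∃ (p : labelObj X {b} i ⊗ labelObj X {b} i ⟶ 𝟙_ F)
      (a : 𝟙_ F ⟶ labelObj X {b} i ⊗ labelObj X {b} i)
      (q : labelObj X {b} i ⊗ labelObj X {b} i ⟶ labelObj X {b} i)
      (j : labelObj X {b} i ⟶ labelObj X {b} i ⊗ labelObj X {b} i),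
      a ≫ p = 𝟙 _ ∧ j ≫ q = 𝟙 _ ∧ (i ≠ b → p ≫ a = 𝟙 _) ∧ (i ≠ b → q ≫ j = 𝟙 _) ∧
        (i = b → p ≫ a + q ≫ j = 𝟙 _) := by
  by_cases hi : i = b
  · rw [labelObj_of_mem X (by simpa using hi)]
    obtain ⟨p, a, q, j, h1, h2, h3⟩ := h.fusion
    exact ⟨p, a, q, j, h1, h2, absurd hi, absurd hi, fun _ => h3⟩
  · rw [labelObj_of_notMem X (by simpa using hi)]
    exact ⟨(ρ_ _).hom, (ρ_ _).inv, (ρ_ _).hom, (ρ_ _).inv, by simp, by simp, by simp, by simp,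
      fun h => absurd h hi⟩

variable [MonoidalPreadditive F] [MonoidalLinear k F] [BraidedCategory F] [RigidCategory F]
  [RibbonTwist F]

open Classical in
theorem ribbonTwist_labelObj {X : F} {θ : k} (hθ : ribbonTwist X = θ • 𝟙 X) {l : ℕ}
    (s : Finset (Fin l)) (i : Fin l) :
    ribbonTwist (labelObj X s i) = (if i ∈ s then θ else 1) • 𝟙 _ := by
  by_cases hi : i ∈ s
  · rw [labelObj_of_mem X hi, if_pos hi, hθ]
  · rw [labelObj_of_notMem X hi, if_neg hi, ribbonTwist_unit, one_smul]

section Deligne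

variable {l : ℕ} {D : Type u'} [Category.{v'} D] [Abelian D] [Linear k D] [MonoidalCategory D]
    [MonoidalPreadditive D] [MonoidalLinear k D] [BraidedCategory D] [RigidCategory D]
    [RibbonTwist D] (hD : DeligneProduct k (fun _ : Fin l => F) D)
    {X : F} (h : IsFibonacciObject k X)
include h

/-- Schur's lemma for external products: a pure tensor of morphisms vanishes if one coordinate does,
and is a product of scalars if every coordinate is scalar. -/
theorem DeligneProduct.hom_box_label (s t : Finset (Fin l))
    (f : hD.box.obj (labelObj X s) ⟶ hD.box.obj (labelObj X t)) :
    (s ≠ t → f = 0) ∧ ∀ hst : s = t, ∃ c : k, f = c • hD.box.map (eqToHom (by rw [hst])) := by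
  obtain ⟨x, rfl⟩ := (hD.boxHom_bijective _ _).2 f
  refine ⟨fun hst => ?_, ?_⟩
  · obtain ⟨i, hi⟩ : ∃ i, ¬ (i ∈ s ↔ i ∈ t) := by
      by_contra hc
      push Not at hc
      exact hst (Finset.ext hc)
    induction x using PiTensorProduct.induction_on with
    | smul_tprod r f =>
      rw [map_smul, PiTensorProduct.lift.tprod,
        MultilinearMap.map_coord_zero _ i (h.hom_labelObj_eq_zero hi (f i)), smul_zero]
    | add x y hx hy => rw [map_add, hx, hy, add_zero]
  · rintro rfl
    induction x using PiTensorProduct.induction_on with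
    | smul_tprod r f =>
      choose c hc using fun i => h.hom_labelObj (f i)
      have : f = fun i => c i • 𝟙 (labelObj X s i) := funext hc
      refine ⟨r * ∏ i, c i, ?_⟩
      rw [map_smul, PiTensorProduct.lift.tprod, this, MultilinearMap.map_smul_univ, smul_smul,
        hD.boxHom_apply]
      rfl
    | add x y hx hy =>
      obtain ⟨c, hc⟩ := hx
      obtain ⟨d, hd⟩ := hy
      exact ⟨c + d, by rw [map_add, hc, hd, add_smul]⟩

theorem DeligneProduct.decomposes_box (Y : Fin l → F) :
    DecomposesInto (fun V => ∃ s, V = hD.box.obj (labelObj X s)) (hD.box.obj Y) := by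
  classical
  choose n V p a hV hpa using fun i => h.decomposes (Y i)
  refine DecomposesInto.of_fintype (ι := ∀ i, Fin (n i)) (fun r => hD.box.obj fun i => V i (r i))
    (fun r => hD.box.map fun i => p i (r i)) (fun r => hD.box.map fun i => a i (r i))
    (fun r => ⟨Finset.univ.filter fun i => V i (r i) = X, ?_⟩) ?_
  · congr 1
    funext i
    by_cases hi : V i (r i) = X
    · rw [labelObj_of_mem X (by simpa using hi), hi]
    · rw [labelObj_of_notMem X (by simpa using hi), (hV i (r i)).resolve_right hi]
  · have h1 : hD.boxHom Y Y (fun i => ∑ j, p i j ≫ a i j) = 𝟙 _ := by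
      have : (fun i => ∑ j, p i j ≫ a i j) = 𝟙 Y := funext hpa
      rw [this, hD.boxHom_apply, CategoryTheory.Functor.map_id]
    rw [← h1, MultilinearMap.map_sum]
    refine Finset.sum_congr rfl fun r _ => ?_
    rw [← Functor.map_comp, ← hD.boxHom_apply]
    rfl

theorem DeligneProduct.decomposes (Z : D) :
    DecomposesInto (fun V => ∃ s, V = hD.box.obj (labelObj X s)) Z := by
  obtain ⟨n, Y, ⟨e⟩⟩ := hD.generates Z
  refine (DecomposesInto.of_iso_biproduct (P := fun V => ∃ Y, V = hD.box.obj Y)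
    (fun j => ⟨_, ⟨Y j, rfl⟩, ⟨Iso.refl _⟩⟩) e).trans ?_
  rintro _ ⟨Y, rfl⟩
  exact hD.decomposes_box h Y

omit h in
theorem DeligneProduct.ribbonTwist_box_label {θ : k} (hθ : ribbonTwist X = θ • 𝟙 X)
    (s : Finset (Fin l)) :
    ribbonTwist (hD.box.obj (labelObj X s)) = θ ^ s.card • 𝟙 _ := by
  classical
  have h1 : (fun i => ribbonTwist (labelObj X s i)) =
      fun i => (if i ∈ s then θ else 1) • 𝟙 (labelObj X s i) :=
    funext (ribbonTwist_labelObj hθ s)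
  have h2 := hD.boxHom_apply _ _ (fun i => ribbonTwist (labelObj X s i))
  rw [← hD.box_twist, ← h2, h1, MultilinearMap.map_smul_univ]
  congr 1
  · simp
  · rw [hD.boxHom_apply]
    exact hD.box.map_id _

theorem DeligneProduct.self_dual (s : Finset (Fin l)) :
    Nonempty (ExactPairing (hD.box.obj (labelObj X s)) (hD.box.obj (labelObj X s))) := by
  let := hD.braided
  obtain ⟨e⟩ := h.nonempty_exactPairing
  obtain ⟨e'⟩ := Pi.nonempty_exactPairing (labelObj X s) (labelObj X s) (fun i => by
    by_cases hi : i ∈ s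
    · rw [labelObj_of_mem X hi]
      exact ⟨e⟩
    · rw [labelObj_of_notMem X hi]
      exact ⟨inferInstance⟩)
  exact nonempty_exactPairing_map hD.box _ _

/-- Away from `b` both idempotents are the identity, so multilinearity lets them be added in
coordinate `b` alone. -/
theorem DeligneProduct.fusion (b : Fin l) : ∃ (p : hD.box.obj (labelObj X {b}) ⊗ hD.box.obj (labelObj X {b}) ⟶ 𝟙_ D)
    (i : 𝟙_ D ⟶ hD.box.obj (labelObj X {b}) ⊗ hD.box.obj (labelObj X {b}))
    (q : hD.box.obj (labelObj X {b}) ⊗ hD.box.obj (labelObj X {b}) ⟶ hD.box.obj (labelObj X {b}))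
    (j : hD.box.obj (labelObj X {b}) ⟶ hD.box.obj (labelObj X {b}) ⊗ hD.box.obj (labelObj X {b})),
    i ≫ p = 𝟙 _ ∧ j ≫ q = 𝟙 _ ∧ p ≫ i + q ≫ j = 𝟙 _ := by
  let := hD.braided
  choose p a q j hap hjq hpa hqj hb using h.exists_splitting b
  let m := Functor.Monoidal.μIso hD.box (labelObj X {b}) (labelObj X {b})
  let e := Functor.Monoidal.εIso hD.box
  let P : labelObj X {b} ⊗ labelObj X {b} ⟶ 𝟙_ (Fin l → F) := p
  let A : 𝟙_ (Fin l → F) ⟶ labelObj X {b} ⊗ labelObj X {b} := a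
  let Q : labelObj X {b} ⊗ labelObj X {b} ⟶ labelObj X {b} := q
  let J : labelObj X {b} ⟶ labelObj X {b} ⊗ labelObj X {b} := j
  have hAP : A ≫ P = 𝟙 _ := funext hap
  have hJQ : J ≫ Q = 𝟙 _ := funext hjq
  have hsum : hD.box.map (P ≫ A) + hD.box.map (Q ≫ J) =
      𝟙 (hD.box.obj (labelObj X {b} ⊗ labelObj X {b})) := by
    rw [← CategoryTheory.Functor.map_id, ← hD.boxHom_apply, ← hD.boxHom_apply, ← hD.boxHom_apply]
    exact MultilinearMap.map_add_of_eq_off _ b _ _ _ hpa hqj (hb b rfl)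
  refine ⟨m.hom ≫ hD.box.map P ≫ e.inv, e.hom ≫ hD.box.map A ≫ m.inv, m.hom ≫ hD.box.map Q,
    hD.box.map J ≫ m.inv, ?_, ?_, ?_⟩
  · simp only [Category.assoc, Iso.inv_hom_id_assoc]
    rw [← Functor.map_comp_assoc, hAP]
    simp
  · simp only [Category.assoc, Iso.inv_hom_id_assoc]
    rw [← Functor.map_comp, hJQ]
    simp
  · have : m.hom ≫ (hD.box.map (P ≫ A) + hD.box.map (Q ≫ J)) ≫ m.inv = 𝟙 _ := by
      rw [hsum]; simp
    rw [← this]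
    simp

omit h in
-- Distinct letters live in different factors, so each coordinate of the product has at most one
-- non-unit term.
theorem DeligneProduct.nonempty_wordObj_iso (w : List (Fin l)) (hw : w.Nodup) :
    Nonempty (wordObj (fun b => hD.box.obj (labelObj X {b})) w ≅
      hD.box.obj (labelObj X w.toFinset)) := by
  let := hD.braided
  induction w with
  | nil =>
    obtain ⟨e⟩ := nonempty_labelObj_empty_iso (l := l) X
    exact ⟨Functor.Monoidal.εIso hD.box ≪≫ (hD.box.mapIso e).symm⟩
  | cons b w ih =>
    rw [List.nodup_cons] at hw
    obtain ⟨e⟩ := ih hw.2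
    obtain ⟨f⟩ := nonempty_labelObj_insert_iso X (b := b) (s := w.toFinset) (by simpa using hw.1)
    rw [List.toFinset_cons]
    exact ⟨whiskerLeftIso _ e ≪≫ Functor.Monoidal.μIso hD.box _ _ ≪≫ hD.box.mapIso f⟩

theorem DeligneProduct.isFibonacciFamily {θ : k} (hθ : ribbonTwist X = θ • 𝟙 X) (hθ1 : θ ≠ 1)
    (hθ2 : θ ^ 2 ≠ 1) : IsFibonacciFamily k (fun b => hD.box.obj (labelObj X {b})) := by
  refine ⟨hD.fusion h, fun b => hD.self_dual h _, fun Z => (hD.decomposes h Z).trans ?_, ?_, ?_,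
    fun V W => (hD.decomposes h V).finite_hom k (hD.decomposes h W) ?_, ?_⟩
  · rintro _ ⟨s, rfl⟩
    obtain ⟨e⟩ := hD.nonempty_wordObj_iso (X := X) s.toList s.nodup_toList
    rw [Finset.toList_toFinset] at e
    exact DecomposesInto.of_iso e.symm ⟨_, s.nodup_toList, rfl⟩
  · intro w w' hw hw' f hf
    obtain ⟨e⟩ := hD.nonempty_wordObj_iso (X := X) w hw
    obtain ⟨e'⟩ := hD.nonempty_wordObj_iso (X := X) w' hw'
    have hf' : e.inv ≫ f ≫ e'.hom ≠ 0 := fun h0 => hf <| by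
      rw [← cancel_epi e.inv, ← cancel_mono e'.hom, Category.assoc, h0]
      simp
    obtain ⟨h1, h2⟩ := hD.hom_box_label h _ _ (e.inv ≫ f ≫ e'.hom)
    have hst := not_not.1 (mt h1 hf')
    obtain ⟨c, hc⟩ := h2 hst
    have hc0 : c ≠ 0 := fun h0 => hf' (by rw [hc, h0, zero_smul])
    have h3 : f = c • (e.hom ≫ hD.box.map (eqToHom (by rw [hst])) ≫ e'.inv) := by
      rw [← cancel_epi e.inv, ← cancel_mono e'.hom, Category.assoc, hc]
      simp
    refine ⟨c⁻¹ • (e'.hom ≫ hD.box.map (eqToHom (by rw [hst])) ≫ e.inv), ?_⟩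
    rw [h3]
    simp only [Linear.smul_comp, Linear.comp_smul, Category.assoc, Iso.inv_hom_id_assoc, smul_smul]
    rw [← Functor.map_comp_assoc]
    simp [hc0]
  · intro f
    obtain ⟨e⟩ : Nonempty (𝟙_ D ≅ hD.box.obj (labelObj X ∅)) :=
      hD.nonempty_wordObj_iso (X := X) [] List.nodup_nil
    obtain ⟨c, hc⟩ := (hD.hom_box_label h _ _ (e.inv ≫ f ≫ e.hom)).2 rfl
    refine ⟨c, ?_⟩
    rw [← cancel_epi e.inv, ← cancel_mono e.hom, Category.assoc, hc, eqToHom_refl,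
      CategoryTheory.Functor.map_id]
    simp
  · rintro _ _ ⟨s, rfl⟩ ⟨t, rfl⟩
    by_cases hst : s = t
    · exact Module.Finite.of_surjective (LinearMap.toSpanSingleton k _
        (hD.box.map (eqToHom (by rw [hst])))) fun f => by
          obtain ⟨c, hc⟩ := (hD.hom_box_label h s t f).2 hst
          exact ⟨c, hc.symm⟩
    · have : Subsingleton (hD.box.obj (labelObj X s) ⟶ hD.box.obj (labelObj X t)) :=
        subsingleton_of_forall_eq 0 fun f => (hD.hom_box_label h s t f).1 hst
      infer_instance
  · intro w hw hl
    obtain ⟨e⟩ := hD.nonempty_wordObj_iso (X := X) w hw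
    have h1 := hD.ribbonTwist_box_label hθ w.toFinset
    rw [List.toFinset_card_of_nodup hw] at h1
    refine ⟨θ ^ w.length, ?_, ?_⟩
    · rcases hl with hl | hl
      · rwa [hl, pow_one]
      · rwa [hl]
    · rw [← cancel_mono e.hom, ← ribbonTwist_naturality, h1]
      simp

end Deligne
end Label

/-! ### The unit component of a separable commutative algebra -/

/-- An element of a `k`-algebra, `k` algebraically closed, is a scalar if the polynomial
expressions in it are not of square zero and not nontrivial idempotents. -/
theorem exists_eq_algebraMap_of_reduced_of_idempotents {k R : Type*} [Field k] [IsAlgClosed k]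
    [Ring R] [Algebra k R] [Nontrivial R] (f : R) (hf : IsIntegral k f)
    (hred : ∀ q : Polynomial k, Polynomial.aeval f q * Polynomial.aeval f q = 0 →
      Polynomial.aeval f q = 0)
    (hidem : ∀ q : Polynomial k, Polynomial.aeval f q * Polynomial.aeval f q =
      Polynomial.aeval f q → Polynomial.aeval f q = 0 ∨ Polynomial.aeval f q = 1) :
    ∃ c : k, f = algebraMap k R c := by
  open Polynomial in
  set p := minpoly k f
  obtain ⟨c, hc⟩ := IsAlgClosed.exists_root p (minpoly.degree_pos hf).ne'
  obtain ⟨q, hq⟩ := dvd_iff_isRoot.2 hc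
  have hp0 : p ≠ 0 := minpoly.ne_zero hf
  have hpf : aeval f p = 0 := minpoly.aeval k f
  have hmin : ∀ r : k[X], ∀ a : k, r ≠ 0 → p = (X - C a) * r → aeval f r ≠ 0 := by
    intro r a hr hpr h0
    have h1 := minpoly.degree_le_of_ne_zero k f hr h0
    change p.degree ≤ _ at h1
    rw [hpr, degree_mul, degree_X_sub_C, degree_eq_natDegree hr] at h1
    norm_cast at h1
    omega
  have hq0 : q ≠ 0 := by rintro rfl; simp at hq; exact hp0 hq
  -- If `c` were a double root, the minimal polynomial would divide `q²`, making `q(f)` of square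
  -- zero and hence zero, against minimality.
  have hqc : q.eval c ≠ 0 := by
    intro h0
    obtain ⟨r, hr⟩ := dvd_iff_isRoot.2 h0
    have h1 : aeval f q = 0 := by
      apply hred
      rw [← map_mul]
      have : q * q = p * r := by rw [hq]; nth_rewrite 2 [hr]; ring
      rw [this, map_mul, hpf, zero_mul]
    exact hmin q c hq0 hq h1
  obtain ⟨s, hs⟩ : X - C c ∣ q - C (q.eval c) := dvd_iff_isRoot.2 (by simp)
  -- As `q ≡ q(c)` modulo `X - c`, the normalised `q` is idempotent modulo `p = (X - c)q`. Its value
  -- at `f` cannot be 0 by minimality, and the value 1 forces `f = c`.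
  have he : aeval f (C (q.eval c)⁻¹ * q) * aeval f (C (q.eval c)⁻¹ * q) =
      aeval f (C (q.eval c)⁻¹ * q) := by
    rw [← map_mul, ← sub_eq_zero, ← map_sub]
    have h1 : C (q.eval c)⁻¹ * q * (C (q.eval c)⁻¹ * q) - C (q.eval c)⁻¹ * q =
        p * (C (q.eval c)⁻¹ ^ 2 * s) := by
      have h2 : C (q.eval c)⁻¹ * C (q.eval c) = 1 := by
        rw [← C_mul, inv_mul_cancel₀ hqc, C_1]
      rw [hq]
      linear_combination (C (q.eval c)⁻¹ ^ 2 * q) * hs + (C (q.eval c)⁻¹ * q) * h2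
    rw [h1, map_mul, hpf, zero_mul]
  have hq1 := hmin q c hq0 hq
  rcases hidem _ he with h0 | h1
  · rw [map_mul, aeval_C] at h0
    refine absurd ?_ hq1
    have := congrArg (fun x => algebraMap k R (q.eval c) * x) h0
    simpa [← mul_assoc, ← map_mul, hqc] using this
  · refine ⟨c, ?_⟩
    have h2 : aeval f (X - C c) * aeval f (C (q.eval c)⁻¹ * q) = 0 := by
      rw [← map_mul]
      have : (X - C c) * (C (q.eval c)⁻¹ * q) = p * C (q.eval c)⁻¹ := by rw [hq]; ring
      rw [this, map_mul, hpf, zero_mul]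
    rw [h1, mul_one] at h2
    simpa [sub_eq_zero] using h2

/-! ### Bilinear endomorphisms and the trace form of an algebra. -/

section Algebra

variable {C : Type u} [Category.{v} C] [MonoidalCategory C]

/-- An endomorphism of an algebra which is linear for both multiplications. -/
structure IsBilinearEnd {A : C} [MonObj A] (f : A ⟶ A) : Prop where
  whiskerRight_mul : f ▷ A ≫ MonObj.mul (X := A) = MonObj.mul (X := A) ≫ f
  whiskerLeft_mul : A ◁ f ≫ MonObj.mul (X := A) = MonObj.mul (X := A) ≫ f

/-- The left multiplication by an element `𝟙 ⟶ A` of an algebra. -/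
def leftMul {A : C} [MonObj A] (r : 𝟙_ C ⟶ A) : A ⟶ A :=
  (λ_ A).inv ≫ r ▷ A ≫ MonObj.mul (X := A)

section

variable {A : C} [MonObj A] {f g : A ⟶ A}

theorem IsBilinearEnd.leftMul_comp (hf : IsBilinearEnd f) (s : 𝟙_ C ⟶ A) :
    leftMul (s ≫ f) = leftMul s ≫ f := by
  rw [leftMul, comp_whiskerRight, Category.assoc, hf.whiskerRight_mul, leftMul]
  simp

theorem IsBilinearEnd.comp_leftMul (hf : IsBilinearEnd f) (s : 𝟙_ C ⟶ A) :
    f ≫ leftMul s = leftMul s ≫ f := by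
  rw [leftMul, leftUnitor_inv_naturality_assoc, whisker_exchange_assoc, hf.whiskerLeft_mul]
  simp

theorem IsBilinearEnd.comp (hf : IsBilinearEnd f) (hg : IsBilinearEnd g) :
    IsBilinearEnd (f ≫ g) := by
  refine ⟨?_, ?_⟩
  · rw [comp_whiskerRight, Category.assoc, hg.whiskerRight_mul, ← Category.assoc,
      hf.whiskerRight_mul, Category.assoc]
  · rw [MonoidalCategory.whiskerLeft_comp, Category.assoc, hg.whiskerLeft_mul, ← Category.assoc,
      hf.whiskerLeft_mul, Category.assoc]

theorem isBilinearEnd_leftMul [BraidedCategory C] [IsCommMonObj A] (r : 𝟙_ C ⟶ A) :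
    IsBilinearEnd (leftMul r) := by
  have h1 : leftMul r ▷ A ≫ MonObj.mul (X := A) = MonObj.mul (X := A) ≫ leftMul r := by
    simp only [leftMul, comp_whiskerRight, Category.assoc, MonObj.mul_assoc]
    rw [leftUnitor_inv_naturality_assoc, whisker_exchange_assoc]
    simp
  refine ⟨h1, ?_⟩
  rw [← IsCommMonObj.mul_comm A, BraidedCategory.braiding_naturality_right_assoc, h1,
    Category.assoc]

/-- A splitting `π ≫ i` of a bilinear idempotent of an algebra makes the image an algebra. -/
theorem IsBilinearEnd.exists_monObj {B : C} {π : A ⟶ B} {i : B ⟶ A} (hi : i ≫ π = 𝟙 B)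
    (h : IsBilinearEnd (π ≫ i)) : ∃ _ : MonObj B, IsMonHom π := by
  -- Bilinearity pulls both copies of the idempotent out of the product, where `π` absorbs them. The
  -- algebra axioms of `B` then follow by cancelling split epimorphisms built from `π`.
  have hπ : (π ⊗ₘ π) ≫ (i ⊗ₘ i) ≫ MonObj.mul (X := A) ≫ π = MonObj.mul (X := A) ≫ π := by
    rw [← Category.assoc, tensorHom_comp_tensorHom, MonoidalCategory.tensorHom_def', Category.assoc,
      reassoc_of% h.whiskerRight_mul, reassoc_of% h.whiskerLeft_mul]
    simp [hi]
  have hs : ∀ {Y Z : C} (f g : Y ⟶ Z) {W : C} (e : W ⟶ Y) (d : Y ⟶ W), d ≫ e = 𝟙 _ →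
      e ≫ f = e ≫ g → f = g := fun f g _ e d hd he => by
    rw [← Category.id_comp f, ← hd, Category.assoc, he, reassoc_of% hd]
  let M : MonObj B :=
    { one := MonObj.one (X := A) ≫ π
      mul := (i ⊗ₘ i) ≫ MonObj.mul (X := A) ≫ π
      one_mul := by
        refine hs _ _ (_ ◁ π) (_ ◁ i) (by rw [← MonoidalCategory.whiskerLeft_comp, hi, MonoidalCategory.whiskerLeft_id]) ?_
        have : 𝟙_ C ◁ π ≫ (MonObj.one (X := A) ≫ π) ▷ B = MonObj.one (X := A) ▷ A ≫ (π ⊗ₘ π) := by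
          rw [whisker_exchange, MonoidalCategory.tensorHom_def]
          simp
        rw [reassoc_of% this, hπ]
        simp
      mul_one := by
        refine hs _ _ (π ▷ _) (i ▷ _) (by rw [← comp_whiskerRight, hi, id_whiskerRight]) ?_
        have : π ▷ 𝟙_ C ≫ B ◁ (MonObj.one (X := A) ≫ π) = A ◁ MonObj.one (X := A) ≫ (π ⊗ₘ π) := by
          rw [← whisker_exchange, MonoidalCategory.tensorHom_def']
          simp
        rw [reassoc_of% this, hπ]
        simp
      mul_assoc := by
        refine hs _ _ ((π ⊗ₘ π) ⊗ₘ π) ((i ⊗ₘ i) ⊗ₘ i)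
          (by simp [tensorHom_comp_tensorHom, hi]) ?_
        have h1 : ((π ⊗ₘ π) ⊗ₘ π) ≫ ((i ⊗ₘ i) ≫ MonObj.mul (X := A) ≫ π) ▷ B =
            MonObj.mul (X := A) ▷ A ≫ (π ⊗ₘ π) := by
          rw [← tensorHom_id, ← tensorHom_id, tensorHom_comp_tensorHom, tensorHom_comp_tensorHom, hπ]
          simp
        have h2 : (π ⊗ₘ (π ⊗ₘ π)) ≫ B ◁ ((i ⊗ₘ i) ≫ MonObj.mul (X := A) ≫ π) =
            A ◁ MonObj.mul (X := A) ≫ (π ⊗ₘ π) := by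
          rw [← id_tensorHom, ← id_tensorHom, tensorHom_comp_tensorHom, tensorHom_comp_tensorHom, hπ]
          simp
        rw [reassoc_of% h1, hπ, associator_naturality_assoc, reassoc_of% h2, hπ,
          MonObj.mul_assoc_assoc] }
  exact ⟨M, ⟨rfl, hπ.symm⟩⟩

end

variable [BraidedCategory C] [RigidCategory C] {A : C} [MonObj A]

theorem comp_algTraceForm (r : 𝟙_ C ⟶ A) :
    r ≫ algTraceForm A = pairingTrace A Aᘁ (leftMul r) := by
  simp only [algTraceForm, pairingTrace, leftMul]
  calc
    _ = 𝟙 _ ⊗≫ (r ▷ 𝟙_ C ≫ A ◁ η_ A Aᘁ) ⊗≫ MonObj.mul (X := A) ▷ Aᘁ ≫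
        (β_ A Aᘁ).hom ≫ ε_ A Aᘁ := by monoidal
    _ = _ := by
      rw [← whisker_exchange]
      monoidal

variable [Abelian C] [MonoidalPreadditive C]

/-- Linearity turns `e(f ⊗ 1)` into the trace form of `f` applied to a product, which is zero; the
copairing `κ` then recovers `f` from `e(f ⊗ 1)`. -/
theorem IsSeparableAlg.eq_zero_of_comp_algTraceForm (hA : IsSeparableAlg A) {f : A ⟶ A}
    (hf : f ▷ A ≫ MonObj.mul (X := A) = MonObj.mul (X := A) ≫ f)
    (h0 : f ≫ algTraceForm A = 0) : f = 0 := by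
  obtain ⟨κ, hκ⟩ := hA
  have h1 : f ▷ A ≫ algPairing A = 0 := by
    rw [algPairing, ← Category.assoc, hf, Category.assoc, h0, comp_zero]
  rw [← Category.comp_id f, ← hκ, rightUnitor_inv_naturality_assoc, ← whisker_exchange_assoc,
    associator_inv_naturality_left_assoc, ← comp_whiskerRight_assoc, h1]
  simp

/-- If `f ≠ 0`, its composite with the trace form has a section `s`. The resulting identity of `𝟙`
is the trace of left multiplication by `s ≫ f`, which has square zero because `f` has; so this trace
vanishes. -/
theorem IsSeparableAlg.sq_ne_zero (hA : IsSeparableAlg A)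
    (hsplit : ∀ g : A ⟶ 𝟙_ C, g ≠ 0 → ∃ s, s ≫ g = 𝟙 _) (h1 : 𝟙 (𝟙_ C) ≠ 0) {f : A ⟶ A}
    (hf : IsBilinearEnd f) (hsq : f ≫ f = 0) : f = 0 := by
  by_contra hf0
  obtain ⟨s, hs⟩ := hsplit (f ≫ algTraceForm A) fun h0 =>
    hf0 (hA.eq_zero_of_comp_algTraceForm hf.whiskerRight_mul h0)
  rw [← Category.assoc, comp_algTraceForm, hf.leftMul_comp, pairingTrace_eq_zero_of_sq] at hs
  · exact h1 hs.symm
  · rw [Category.assoc, reassoc_of% hf.comp_leftMul, hsq]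
    simp

/-- The images of `f` and `1 - f` are algebras with product `A`, so one of them is zero. -/
theorem IsIndecomposableAlg.eq_zero_or_eq_id (hA : IsIndecomposableAlg A) {f : A ⟶ A}
    (hf : IsBilinearEnd f) (hf' : IsBilinearEnd (𝟙 A - f)) (hidem : f ≫ f = f) :
    f = 0 ∨ f = 𝟙 A := by
  have hidem' : (𝟙 A - f) ≫ (𝟙 A - f) = 𝟙 A - f := by simp [hidem]
  have key : ∀ g : A ⟶ A, g ≫ g = g → image.ι g ≫ factorThruImage g = 𝟙 _ := fun g hg => by
    rw [← cancel_epi (factorThruImage g), ← cancel_mono (image.ι g)]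
    simpa using hg
  have h1 := image.fac f
  have h2 := image.fac (𝟙 A - f)
  obtain ⟨M, hM⟩ := IsBilinearEnd.exists_monObj (key f hidem) (h1.symm ▸ hf)
  obtain ⟨M', hM'⟩ := IsBilinearEnd.exists_monObj (key _ hidem') (h2.symm ▸ hf')
  have hz : f ≫ (𝟙 A - f) = 0 := by simp [hidem]
  have hz' : (𝟙 A - f) ≫ f = 0 := by simp [hidem]
  have h12 : image.ι f ≫ factorThruImage (𝟙 A - f) = 0 := by
    rw [← cancel_epi (factorThruImage f), ← cancel_mono (image.ι (𝟙 A - f))]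
    simpa using hz
  have h21 : image.ι (𝟙 A - f) ≫ factorThruImage f = 0 := by
    rw [← cancel_epi (factorThruImage (𝟙 A - f)), ← cancel_mono (image.ι f)]
    simpa using hz'
  have hiso : IsIso (biprod.lift (factorThruImage f) (factorThruImage (𝟙 A - f))) := by
    refine ⟨biprod.desc (image.ι f) (image.ι (𝟙 A - f)), ?_, ?_⟩
    · rw [biprod.lift_desc, h1, h2]; simp
    · apply biprod.hom_ext' <;> apply biprod.hom_ext <;> simp [key f hidem, key _ hidem', h12, h21]
  rcases hA.2 _ _ _ _ hiso with h | h
  · left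
    rw [← h1, h.eq_of_src (image.ι f) 0, comp_zero]
  · right
    rw [h.eq_of_src (image.ι (𝟙 A - f)) 0, comp_zero] at h2
    exact (sub_eq_zero.1 h2.symm).symm

/-- The endomorphisms of an indecomposable separable commutative algebra which come from its
unit component are scalars. -/
theorem IsIndecomposableAlg.exists_eq_smul_one {k : Type w} [Field k] [IsAlgClosed k] [Linear k C]
    [MonoidalLinear k C] [IsCommMonObj A] [Module.Finite k (A ⟶ A)] (hA : IsIndecomposableAlg A)
    (hA' : IsSeparableAlg A) (hsplit : ∀ g : A ⟶ 𝟙_ C, g ≠ 0 → ∃ s, s ≫ g = 𝟙 _)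
    (r : 𝟙_ C ⟶ A) : ∃ c : k, r = c • MonObj.one (X := A) := by
  have hA0 : 𝟙 A ≠ 0 := fun h => hA.1 ((IsZero.iff_id_eq_zero A).2 h)
  have h1 : 𝟙 (𝟙_ C) ≠ 0 := fun h => hA0 <| by
    rw [← cancel_epi (λ_ A).hom, Category.comp_id, ← Category.id_comp (λ_ A).hom,
      ← id_whiskerRight, h]
    simp
  -- Bilinear endomorphisms form a subalgebra, so every polynomial in a left multiplication is again
  -- bilinear and the two preceding lemmas apply to it.
  let S : Subalgebra k (End A) :=
    { carrier := {f | IsBilinearEnd (A := A) f}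
      mul_mem' := fun {f g} hf hg => IsBilinearEnd.comp hg hf
      add_mem' := fun {f g} hf hg => by
        refine ⟨?_, ?_⟩
        · change ((f : A ⟶ A) + g) ▷ A ≫ _ = _ ≫ ((f : A ⟶ A) + g)
          rw [MonoidalPreadditive.add_whiskerRight, Preadditive.add_comp, Preadditive.comp_add,
            hf.whiskerRight_mul, hg.whiskerRight_mul]
        · change A ◁ ((f : A ⟶ A) + g) ≫ _ = _ ≫ ((f : A ⟶ A) + g)
          rw [MonoidalPreadditive.whiskerLeft_add, Preadditive.add_comp, Preadditive.comp_add,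
            hf.whiskerLeft_mul, hg.whiskerLeft_mul]
      algebraMap_mem' := fun c => by
        refine ⟨?_, ?_⟩
        · change (c • 𝟙 A) ▷ A ≫ _ = _ ≫ (c • 𝟙 A)
          simp
        · change A ◁ (c • 𝟙 A) ≫ _ = _ ≫ (c • 𝟙 A)
          simp }
  have : Nontrivial (End A) := ⟨𝟙 A, 0, hA0⟩
  have : Module.Finite k (End A) := inferInstanceAs (Module.Finite k (A ⟶ A))
  let f : End A := leftMul r
  have hf : f ∈ S := isBilinearEnd_leftMul r
  have hq : ∀ q : Polynomial k, Polynomial.aeval f q ∈ S := fun q => by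
    have := (Polynomial.aeval (⟨f, hf⟩ : S) q).2
    rwa [Polynomial.aeval_subalgebra_coe] at this
  obtain ⟨c, hc⟩ := exists_eq_algebraMap_of_reduced_of_idempotents (k := k) f
    (Algebra.IsIntegral.isIntegral f) (fun q h => hA'.sq_ne_zero hsplit h1 (hq q) h)
    (fun q h => hA.eq_zero_or_eq_id (hq q) (sub_mem (one_mem S) (hq q)) h)
  refine ⟨c, ?_⟩
  have h2 : MonObj.one (X := A) ≫ leftMul r = r := by
    rw [leftMul, leftUnitor_inv_naturality_assoc, whisker_exchange_assoc]
    simp [unitors_inv_equal]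
  have h3 : leftMul r = c • 𝟙 A := hc
  rw [← h2, h3]
  simp

end Algebra

/-! ### Free modules over an algebra -/

section FreeModule

variable {C : Type u} [Category.{v} C] [MonoidalCategory C] {A : C} [MonObj A] {U V W Z : C}

/-- The extension of a morphism `Z ⟶ W ⊗ A` to a morphism of free right `A`-modules. -/
def freeExt (φ : Z ⟶ W ⊗ A) : Z ⊗ A ⟶ W ⊗ A :=
  φ ▷ A ≫ (α_ W A A).hom ≫ W ◁ MonObj.mul (X := A)

/-- The inclusion of the generators of a free right `A`-module. -/
def freeUnit (Z A : C) [MonObj A] : Z ⟶ Z ⊗ A :=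
  (ρ_ Z).inv ≫ Z ◁ MonObj.one (X := A)

/-- A morphism of free right `A`-modules. -/
def IsFreeLinear (Ψ : Z ⊗ A ⟶ W ⊗ A) : Prop :=
  (α_ Z A A).hom ≫ Z ◁ MonObj.mul (X := A) ≫ Ψ = Ψ ▷ A ≫ (α_ W A A).hom ≫ W ◁ MonObj.mul (X := A)

/-- With `IsFreeLinear.freeExt_freeUnit_comp`, this is the adjunction identifying module maps `Z ⊗ A
⟶ W ⊗ A` with morphisms `Z ⟶ W ⊗ A`. -/
theorem freeUnit_comp_freeExt (φ : Z ⟶ W ⊗ A) : freeUnit Z A ≫ freeExt φ = φ := by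
  rw [freeUnit, freeExt, Category.assoc, whisker_exchange_assoc]
  have : (W ⊗ A) ◁ MonObj.one (X := A) ≫ (α_ W A A).hom ≫ W ◁ MonObj.mul (X := A) =
      (ρ_ _).hom := by
    rw [associator_naturality_right_assoc, ← MonoidalCategory.whiskerLeft_comp, MonObj.mul_one]
    simp
  rw [this]
  simp

theorem isFreeLinear_freeExt (φ : Z ⟶ W ⊗ A) : IsFreeLinear (freeExt φ) := by
  rw [IsFreeLinear, freeExt]
  calc
    _ = (α_ Z A A).hom ≫ (Z ◁ MonObj.mul (X := A) ≫ φ ▷ A) ≫ (α_ W A A).hom ≫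
        W ◁ MonObj.mul (X := A) := by simp
    _ = 𝟙 _ ⊗≫ φ ▷ A ▷ A ⊗≫ W ◁ (A ◁ MonObj.mul (X := A) ≫ MonObj.mul (X := A)) := by
        rw [whisker_exchange]; monoidal
    _ = _ := by
        have h := MonObj.mul_assoc A
        rw [← Iso.inv_comp_eq] at h
        rw [← h]
        monoidal

theorem IsFreeLinear.freeExt_freeUnit_comp {Ψ : Z ⊗ A ⟶ W ⊗ A} (h : IsFreeLinear Ψ) :
    freeExt (freeUnit Z A ≫ Ψ) = Ψ := by
  rw [freeExt, comp_whiskerRight, Category.assoc, ← h, freeUnit]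
  have : ((ρ_ Z).inv ≫ Z ◁ MonObj.one (X := A)) ▷ A ≫ (α_ Z A A).hom ≫
      Z ◁ MonObj.mul (X := A) = 𝟙 _ := by
    rw [comp_whiskerRight, Category.assoc, associator_naturality_middle_assoc,
      ← MonoidalCategory.whiskerLeft_comp, MonObj.one_mul]
    simp
  rw [reassoc_of% this]

theorem IsFreeLinear.comp {Ψ : Z ⊗ A ⟶ W ⊗ A} {Ψ' : W ⊗ A ⟶ V ⊗ A} (h : IsFreeLinear Ψ)
    (h' : IsFreeLinear Ψ') : IsFreeLinear (Ψ ≫ Ψ') := by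
  rw [IsFreeLinear, reassoc_of% h, h', comp_whiskerRight, Category.assoc]

theorem isFreeLinear_whiskerRight (E : Z ⟶ W) : IsFreeLinear (E ▷ A) := by
  rw [IsFreeLinear, whisker_exchange]
  simp

/-- Tensoring a morphism of free right `A`-modules with an object on the left. -/
def freeWhisker (U : C) (Ψ : Z ⊗ A ⟶ W ⊗ A) : (U ⊗ Z) ⊗ A ⟶ (U ⊗ W) ⊗ A :=
  (α_ U Z A).hom ≫ U ◁ Ψ ≫ (α_ U W A).inv

theorem IsFreeLinear.freeWhisker {Ψ : Z ⊗ A ⟶ W ⊗ A} (h : IsFreeLinear Ψ) (U : C) :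
    IsFreeLinear (freeWhisker U Ψ) := by
  rw [IsFreeLinear, _root_.freeWhisker]
  calc
    _ = 𝟙 _ ⊗≫ U ◁ ((α_ Z A A).hom ≫ Z ◁ MonObj.mul (X := A) ≫ Ψ) ⊗≫ 𝟙 _ := by monoidal
    _ = _ := by rw [h]; monoidal

theorem freeWhisker_comp (U : C) (Ψ : Z ⊗ A ⟶ W ⊗ A) (Ψ' : W ⊗ A ⟶ V ⊗ A) :
    freeWhisker U Ψ ≫ freeWhisker U Ψ' = freeWhisker U (Ψ ≫ Ψ') := by
  simp [freeWhisker]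

theorem freeWhisker_id (U : C) : freeWhisker U (𝟙 (Z ⊗ A)) = 𝟙 _ := by
  simp [freeWhisker]

theorem freeExt_freeUnit : freeExt (freeUnit Z A) = 𝟙 (Z ⊗ A) := by
  have : IsFreeLinear (𝟙 (Z ⊗ A)) := by simp [IsFreeLinear]
  rw [← Category.comp_id (freeUnit Z A), this.freeExt_freeUnit_comp]

theorem freeExt_comp_freeExt (φ : Z ⟶ W ⊗ A) (ψ : W ⟶ V ⊗ A) :
    freeExt φ ≫ freeExt ψ = freeExt (φ ≫ freeExt ψ) := by
  rw [← ((isFreeLinear_freeExt φ).comp (isFreeLinear_freeExt ψ)).freeExt_freeUnit_comp,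
    ← Category.assoc, freeUnit_comp_freeExt]

variable [Preadditive C] [MonoidalPreadditive C]

theorem IsFreeLinear.eq_zero {Ψ : Z ⊗ A ⟶ W ⊗ A} (h : IsFreeLinear Ψ)
    (h0 : freeUnit Z A ≫ Ψ = 0) : Ψ = 0 := by
  rw [← h.freeExt_freeUnit_comp, h0]
  simp [freeExt]

section Linear

variable {k : Type w} [Field k] [Linear k C] [MonoidalLinear k C]

/-- If the free module on `W` is a retract of the free module on `Z`, and all morphisms
`U ⊗ Z ⟶ (U ⊗ Z) ⊗ A` are proportional, then all endomorphisms of `U ⊗ W` are scalars. -/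
theorem end_eq_smul_of_freeExt_section {r : A ⟶ 𝟙_ C} (hr : MonObj.one (X := A) ≫ r = 𝟙 _)
    (f : Z ⟶ W ⊗ A) (g : W ⟶ Z ⊗ A) (hgf : g ≫ freeExt f = freeUnit W A) (U : C)
    {ψ : U ⊗ Z ⟶ (U ⊗ Z) ⊗ A} (hψ : ∀ φ : U ⊗ Z ⟶ (U ⊗ Z) ⊗ A, ∃ c : k, φ = c • ψ)
    (E : U ⊗ W ⟶ U ⊗ W) : ∃ c : k, E = c • 𝟙 _ := by
  have hwhisk : freeWhisker U (freeExt g) ≫ freeWhisker U (freeExt f) = 𝟙 _ := by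
    rw [freeWhisker_comp, freeExt_comp_freeExt, hgf, freeExt_freeUnit, freeWhisker_id]
  -- `Φ` carries endomorphisms of `U ⊗ W` through the retraction to module endomorphisms on `U ⊗ Z`.
  -- It is injective: the retraction recovers `E ▷ A`, and `r` recovers `E`.
  let Φ : (U ⊗ W ⟶ U ⊗ W) → ((U ⊗ Z) ⊗ A ⟶ (U ⊗ Z) ⊗ A) := fun E =>
    freeWhisker U (freeExt f) ≫ E ▷ A ≫ freeWhisker U (freeExt g)
  have hΦlin : ∀ E, IsFreeLinear (Φ E) := fun E =>
    ((isFreeLinear_freeExt f).freeWhisker U).comp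
      ((isFreeLinear_whiskerRight E).comp ((isFreeLinear_freeExt g).freeWhisker U))
  have hΦ : ∀ E, freeUnit (U ⊗ Z) A ≫ Φ E = 0 → E = 0 := fun E hE => by
    have h2 := (hΦlin E).eq_zero hE
    have h3 : freeWhisker U (freeExt g) ≫ Φ E ≫ freeWhisker U (freeExt f) = E ▷ A := by
      simp only [Φ, Category.assoc]
      rw [reassoc_of% hwhisk, hwhisk, Category.comp_id]
    rw [h2, zero_comp, comp_zero] at h3
    have h4 : (ρ_ _).inv ≫ (U ⊗ W) ◁ MonObj.one (X := A) ≫ E ▷ A ≫ (U ⊗ W) ◁ r ≫ (ρ_ _).hom =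
        E := by
      rw [whisker_exchange_assoc, ← MonoidalCategory.whiskerLeft_comp_assoc, hr]
      simp
    rw [← h4, ← h3]
    simp
  obtain ⟨x, hx⟩ := hψ (freeUnit (U ⊗ Z) A ≫ Φ (𝟙 _))
  obtain ⟨y, hy⟩ := hψ (freeUnit (U ⊗ Z) A ≫ Φ E)
  have hxy : x • E - y • 𝟙 _ = 0 := by
    apply hΦ
    have : Φ (x • E - y • 𝟙 _) = x • Φ E - y • Φ (𝟙 _) := by
      have h5 : (x • E - y • 𝟙 (U ⊗ W)) ▷ A = x • E ▷ A - y • 𝟙 (U ⊗ W) ▷ A := by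
        rw [sub_eq_add_neg, ← neg_smul, MonoidalPreadditive.add_whiskerRight,
          MonoidalLinear.smul_whiskerRight, MonoidalLinear.smul_whiskerRight, neg_smul,
          ← sub_eq_add_neg]
      simp only [Φ, h5, Preadditive.sub_comp, Preadditive.comp_sub, Linear.smul_comp,
        Linear.comp_smul]
    rw [this, Preadditive.comp_sub, Linear.comp_smul, Linear.comp_smul, hx, hy, smul_smul,
      smul_smul, mul_comm, sub_self]
  -- If `x = 0`, then `Φ` kills the identity, so `U ⊗ W` is zero.
  by_cases hx0 : x = 0
  · rw [hx0, zero_smul] at hx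
    exact ⟨0, by rw [zero_smul, ← Category.id_comp E, hΦ _ hx, zero_comp]⟩
  · refine ⟨x⁻¹ * y, ?_⟩
    rw [mul_smul, ← sub_eq_zero.1 hxy, smul_smul, inv_mul_cancel₀ hx0, one_smul]

end Linear

end FreeModule

section

variable {C : Type u} [Category.{v} C] [MonoidalCategory C] [BraidedCategory C]
  [RigidCategory C] [Abelian C] [MonoidalPreadditive C] {A : C} [MonObj A] {W Z : C}

/-- The composite pairs the `A`-leg of `f` with a second copy of `A`; the copairing `κ` undoes this.
-/
theorem IsSeparableAlg.eq_zero_of_freeExt_comp (hA : IsSeparableAlg A) (f : Z ⟶ W ⊗ A)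
    (h0 : freeExt f ≫ W ◁ algTraceForm A ≫ (ρ_ W).hom = 0) : f = 0 := by
  obtain ⟨κ, hκ⟩ := hA
  have h : (ρ_ Z).inv ≫ Z ◁ κ ≫ (α_ Z A A).inv ≫
      (freeExt f ≫ W ◁ algTraceForm A ≫ (ρ_ W).hom) ▷ A = f := by
    calc
      _ = 𝟙 _ ⊗≫ (Z ◁ κ ≫ f ▷ (A ⊗ A)) ⊗≫ W ◁ (algPairing A) ▷ A ⊗≫ 𝟙 _ := by
        rw [freeExt, algPairing]
        monoidal
      _ = f ≫ W ◁ ((ρ_ A).inv ≫ A ◁ κ ≫ (α_ A A A).inv ≫ algPairing A ▷ A ≫ (λ_ A).hom) := by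
        rw [whisker_exchange]
        monoidal
      _ = f := by rw [hκ]; simp
  rw [← h, h0]
  simp

end

/-! ### Words -/

theorem nonempty_wordObj_iso_of_perm {ι : Type*} {D : Type u} [Category.{v} D]
    [MonoidalCategory D] [BraidedCategory D] (X : ι → D) {w w' : List ι} (h : w.Perm w') :
    Nonempty (wordObj X w ≅ wordObj X w') := by
  induction h with
  | nil => exact ⟨Iso.refl _⟩
  | cons b _ ih => exact ⟨whiskerLeftIso _ ih.some⟩
  | swap a b l =>
    exact ⟨(α_ _ _ _).symm ≪≫ whiskerRightIso (β_ (X b) (X a)) _ ≪≫ α_ _ _ _⟩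
  | trans _ _ h1 h2 => exact ⟨h1.some ≪≫ h2.some⟩

/-! ### Morphisms from words into free modules. -/

namespace IsFibonacciFamily

variable {k : Type w} [Field k] {ι : Type} {D : Type u} [Category.{v} D]
  [Abelian D] [Linear k D] [MonoidalCategory D] [MonoidalPreadditive D] [MonoidalLinear k D]
  [BraidedCategory D] [RigidCategory D] [RibbonTwist D] {X : ι → D}

section

variable (hX : IsFibonacciFamily k X)
include hX

theorem exists_section {V : D} {w : List ι} (hw : w.Nodup) (f : V ⟶ wordObj X w) (hf : f ≠ 0) :
    ∃ g, g ≫ f = 𝟙 _ := by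
  obtain ⟨n, V', p, i, hV, hpi⟩ := hX.decomposes V
  obtain ⟨a, ha⟩ : ∃ a, i a ≫ f ≠ 0 := by
    by_contra! h
    apply hf
    rw [← Category.id_comp f, ← hpi, Preadditive.sum_comp]
    exact Finset.sum_eq_zero fun a _ => by rw [Category.assoc, h a, comp_zero]
  obtain ⟨w', hw', h'⟩ := hV a
  generalize i a = i' at ha
  revert i'
  rw [h']
  intro i' hi'
  obtain ⟨g, hg⟩ := hX.split w' w hw' hw _ hi'
  exact ⟨g ≫ i', by rw [Category.assoc, hg]⟩

variable {A : D} {W Z : D} (b : ι)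

theorem hom_cons_right_eq_zero (h : ∀ φ : X b ⊗ Z ⟶ W ⊗ A, φ = 0) (φ : Z ⟶ (X b ⊗ W) ⊗ A) :
    φ = 0 := by
  obtain ⟨_⟩ := hX.self_dual b
  have h1 := (tensorLeftHomEquiv Z (X b) (X b) (W ⊗ A)).apply_symm_apply (φ ≫ (α_ _ _ _).hom)
  rw [h ((tensorLeftHomEquiv Z (X b) (X b) (W ⊗ A)).symm _)] at h1
  rw [← cancel_mono (α_ _ _ _).hom, ← h1]
  simp [tensorLeftHomEquiv]

theorem hom_cons_left_eq_zero (h : ∀ φ : Z ⟶ (X b ⊗ W) ⊗ A, φ = 0) (φ : X b ⊗ Z ⟶ W ⊗ A) :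
    φ = 0 := by
  obtain ⟨_⟩ := hX.self_dual b
  have h1 := (tensorLeftHomEquiv Z (X b) (X b) (W ⊗ A)).symm_apply_apply φ
  have h2 : tensorLeftHomEquiv Z (X b) (X b) (W ⊗ A) φ = 0 := by
    rw [← cancel_mono (α_ _ _ _).inv, h (_ ≫ (α_ _ _ _).inv), zero_comp]
  rw [h2] at h1
  rw [← h1]
  simp [tensorLeftHomEquiv]

theorem hom_cons_right_eq_smul {ψ : X b ⊗ Z ⟶ W ⊗ A}
    (h : ∀ φ : X b ⊗ Z ⟶ W ⊗ A, ∃ c : k, φ = c • ψ) :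
    ∃ ψ' : Z ⟶ (X b ⊗ W) ⊗ A, ∀ φ : Z ⟶ (X b ⊗ W) ⊗ A, ∃ c : k, φ = c • ψ' := by
  obtain ⟨_⟩ := hX.self_dual b
  refine ⟨tensorLeftHomEquiv Z (X b) (X b) (W ⊗ A) ψ ≫ (α_ _ _ _).inv, fun φ => ?_⟩
  have h1 := (tensorLeftHomEquiv Z (X b) (X b) (W ⊗ A)).apply_symm_apply (φ ≫ (α_ _ _ _).hom)
  obtain ⟨c, hc⟩ := h ((tensorLeftHomEquiv Z (X b) (X b) (W ⊗ A)).symm (φ ≫ (α_ _ _ _).hom))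
  refine ⟨c, ?_⟩
  rw [hc] at h1
  rw [← cancel_mono (α_ _ _ _).hom, ← h1]
  simp [tensorLeftHomEquiv]

/-- Two letters `b` fuse: a morphism from `X b ⊗ X b ⊗ Z` is determined by its restriction to `Z`
if there is no morphism from `X b ⊗ Z`. -/
theorem exists_factor (h0 : ∀ φ : X b ⊗ Z ⟶ W, φ = 0) :
    ∃ s : X b ⊗ X b ⊗ Z ⟶ Z, ∀ φ : X b ⊗ X b ⊗ Z ⟶ W, ∃ φ' : Z ⟶ W, φ = s ≫ φ' := by
  obtain ⟨p, i, q, j, -, -, hpq⟩ := hX.fusion b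
  refine ⟨(α_ _ _ _).inv ≫ p ▷ Z ≫ (λ_ Z).hom, fun φ => ⟨(λ_ Z).inv ≫ i ▷ Z ≫ (α_ _ _ _).hom ≫ φ, ?_⟩⟩
  have h1 : (α_ _ _ _).inv ≫ (p ≫ i + q ≫ j) ▷ Z ≫ (α_ _ _ _).hom ≫ φ = φ := by
    rw [hpq]; simp
  rw [MonoidalPreadditive.add_whiskerRight, Preadditive.add_comp, Preadditive.comp_add,
    comp_whiskerRight q, Category.assoc, h0 (j ▷ Z ≫ _), comp_zero, comp_zero, add_zero] at h1
  nth_rewrite 1 [← h1]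
  simp

/-- Duality moves the target's `X b` to the source, where `X b ⊗ X b ≅ 𝟙 ⊕ X b` leaves the two Hom
spaces assumed to vanish. -/
theorem hom_cons_eq_zero (h : ∀ φ : Z ⟶ W ⊗ A, φ = 0) (h0 : ∀ φ : X b ⊗ Z ⟶ W ⊗ A, φ = 0)
    (φ : X b ⊗ Z ⟶ (X b ⊗ W) ⊗ A) : φ = 0 := by
  refine hX.hom_cons_right_eq_zero b (fun ψ => ?_) φ
  obtain ⟨s, hs⟩ := hX.exists_factor b h0
  obtain ⟨ψ', rfl⟩ := hs ψ
  rw [h ψ', comp_zero]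

theorem hom_cons_eq_smul {ψ : Z ⟶ W ⊗ A} (h : ∀ φ : Z ⟶ W ⊗ A, ∃ c : k, φ = c • ψ)
    (h0 : ∀ φ : X b ⊗ Z ⟶ W ⊗ A, φ = 0) :
    ∃ ψ' : X b ⊗ Z ⟶ (X b ⊗ W) ⊗ A, ∀ φ : X b ⊗ Z ⟶ (X b ⊗ W) ⊗ A, ∃ c : k, φ = c • ψ' := by
  obtain ⟨s, hs⟩ := hX.exists_factor b h0
  refine hX.hom_cons_right_eq_smul b (ψ := s ≫ ψ) fun φ => ?_
  obtain ⟨φ', rfl⟩ := hs φ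
  obtain ⟨c, rfl⟩ := h φ'
  exact ⟨c, by simp⟩

/-- If `A` contains no nonempty word of length less than `n`, then there are no morphisms of free
`A`-modules from a proper extension of a word to the word. -/
theorem hom_append_eq_zero {n : ℕ} (hA : ∀ w : List ι, w.Nodup → w ≠ [] → w.length < n →
    ∀ φ : wordObj X w ⟶ A, φ = 0) (w : List ι) : ∀ v : List ι, v ≠ [] → (v ++ w).Nodup →
    (v ++ w).length < n → ∀ φ : wordObj X (v ++ w) ⟶ wordObj X w ⊗ A, φ = 0 := by
  induction w with
  | nil =>
    intro v hv hn hl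
    change ∀ φ : _ ⟶ 𝟙_ D ⊗ A, φ = 0
    intro φ
    rw [← cancel_mono (λ_ A).hom, zero_comp]
    exact hA _ hn (by simpa using hv) hl _
  | cons b w ih =>
    intro v hv hn hl φ
    have hp : (v ++ b :: w).Perm (b :: (v ++ w)) := List.perm_middle
    obtain ⟨e⟩ := nonempty_wordObj_iso_of_perm X hp
    have hn' := hp.nodup_iff.1 hn
    have hl' := hp.length_eq ▸ hl
    rw [← cancel_epi e.inv, comp_zero]
    -- The unit summand drops `b`; the other keeps it and moves it into the prefix, with the total
    -- length unchanged.
    exact hX.hom_cons_eq_zero b (ih v hv hn'.of_cons (by simp at hl' ⊢; omega))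
      (ih (b :: v) (by simp) hn' hl') _

/-- Each letter peels off both sides: of the two summands after fusion, the one keeping the letter
vanishes by `hom_append_eq_zero`. What remains at the end is `Hom(𝟙, A)`. -/
theorem hom_word_eq_smul [MonObj A] (h1 : ∀ r : 𝟙_ D ⟶ A, ∃ c : k, r = c • MonObj.one (X := A))
    {n : ℕ} (hA : ∀ w : List ι, w.Nodup → w ≠ [] → w.length < n →
    ∀ φ : wordObj X w ⟶ A, φ = 0) (w : List ι) (hw : w.Nodup) (hl : w.length < n) :
    ∃ ψ : wordObj X w ⟶ wordObj X w ⊗ A, ∀ φ : wordObj X w ⟶ wordObj X w ⊗ A,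
      ∃ c : k, φ = c • ψ := by
  induction w with
  | nil =>
    change ∃ ψ : 𝟙_ D ⟶ 𝟙_ D ⊗ A, ∀ φ : 𝟙_ D ⟶ 𝟙_ D ⊗ A, ∃ c : k, φ = c • ψ
    refine ⟨MonObj.one (X := A) ≫ (λ_ A).inv, fun φ => ?_⟩
    obtain ⟨c, hc⟩ := h1 (φ ≫ (λ_ A).hom)
    refine ⟨c, ?_⟩
    rw [← cancel_mono (λ_ A).hom, hc]
    simp
  | cons b w ih =>
    obtain ⟨ψ, hψ⟩ := ih hw.of_cons (by simp at hl; omega)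
    exact hX.hom_cons_eq_smul b hψ (hX.hom_append_eq_zero hA w [b] (by simp) hw hl)

theorem hom_word_append_eq_zero (w : List ι) : ∀ z : List ι,
    (∀ φ : wordObj X z ⟶ wordObj X w ⊗ A, φ = 0) →
    ∀ φ : wordObj X (w ++ z) ⟶ A, φ = 0 := by
  induction w with
  | nil =>
    intro z h φ
    rw [← cancel_mono (λ_ A).inv, zero_comp]
    exact h _
  | cons b w ih =>
    intro z h φ
    obtain ⟨e⟩ := nonempty_wordObj_iso_of_perm X (List.perm_middle (a := b) (l₁ := w) (l₂ := z))
    rw [← cancel_epi e.hom, comp_zero]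
    exact ih (b :: z) (hX.hom_cons_left_eq_zero b h) _

/-- The endomorphisms of `X b ⊗ X b ⊗ Z` are not all scalars. -/
theorem exists_end_ne_smul (h0 : 𝟙 (X b ⊗ Z) ≠ 0) :
    ∃ e : X b ⊗ X b ⊗ Z ⟶ X b ⊗ X b ⊗ Z, ∀ c : k, e ≠ c • 𝟙 _ := by
  obtain ⟨p, i, q, j, hip, hjq, hpq⟩ := hX.fusion b
  -- The projection onto the unit summand of `X b ⊗ X b`: it kills the image of `j` and fixes that
  -- of `i`, so it is not scalar.
  refine ⟨(α_ _ _ _).inv ≫ (p ≫ i) ▷ Z ≫ (α_ _ _ _).hom, fun c hc => ?_⟩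
  have hc' : (p ≫ i) ▷ Z = c • 𝟙 ((X b ⊗ X b) ⊗ Z) := by
    rw [← cancel_epi (α_ _ _ _).inv, ← cancel_mono (α_ _ _ _).hom, Category.assoc, hc]
    simp
  have hjp : j ≫ p = 0 := by
    have h1 : j ≫ (p ≫ i + q ≫ j) ≫ p = j ≫ p := by rw [hpq]; simp
    simp only [Preadditive.add_comp, Preadditive.comp_add, Category.assoc, hip, reassoc_of% hjq,
      Category.comp_id] at h1
    simpa using h1
  have h1 : c • (j ▷ Z) = 0 := by
    have : j ▷ Z ≫ (p ≫ i) ▷ Z = 0 := by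
      rw [← comp_whiskerRight, reassoc_of% hjp]; simp
    rw [hc'] at this
    simpa using this
  rcases smul_eq_zero.1 h1 with h2 | h2
  · rw [h2, zero_smul] at hc'
    have h3 : 𝟙 (𝟙_ D ⊗ Z) = 0 := by
      have : i ▷ Z ≫ (p ≫ i) ▷ Z ≫ p ▷ Z = 𝟙 _ := by
        rw [← comp_whiskerRight, ← comp_whiskerRight, Category.assoc, hip, Category.comp_id, hip,
          id_whiskerRight]
      rw [← this, hc']
      simp
    have h4 : 𝟙 Z = 0 := by
      rw [← cancel_epi (λ_ Z).hom, Category.comp_id, ← Category.id_comp (λ_ Z).hom, h3]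
      simp
    apply h0
    rw [← MonoidalCategory.whiskerLeft_id, h4]
    simp
  · apply h0
    rw [← id_whiskerRight, ← hjq, comp_whiskerRight, h2, zero_comp]

end

/-! ### Excluding every nonempty word from the algebra. -/

section

variable [IsAlgClosed k] (hX : IsFibonacciFamily k X) {A : D} [MonObj A] [IsCommMonObj A]
  (hA : IsIndecomposableAlg A) (hA' : IsSeparableAlg A)
include hX hA hA'

theorem exists_eq_smul_one (r : 𝟙_ D ⟶ A) : ∃ c : k, r = c • MonObj.one (X := A) := by
  have := hX.finite_hom A A
  exact hA.exists_eq_smul_one hA' (fun g hg => hX.exists_section (w := []) List.nodup_nil g hg) r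

/-- The trace form is nonzero, hence has a section, which must be a multiple of the unit; rescaling
the trace form gives the retraction. -/
theorem exists_retraction_one : ∃ r : A ⟶ 𝟙_ D, MonObj.one (X := A) ≫ r = 𝟙 _ := by
  have h0 : algTraceForm A ≠ 0 := fun h => hA.1 <| (IsZero.iff_id_eq_zero A).2 <|
    hA'.eq_zero_of_comp_algTraceForm (by simp) (by rw [h, comp_zero])
  obtain ⟨s, hs⟩ := hX.exists_section (w := []) List.nodup_nil (algTraceForm A) h0
  change 𝟙_ D ⟶ A at s
  change s ≫ algTraceForm A = 𝟙 (𝟙_ D) at hs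
  obtain ⟨c, rfl⟩ := hX.exists_eq_smul_one hA hA' s
  exact ⟨c • algTraceForm A, by rw [← hs]; simp⟩

theorem hom_word_eq_zero_of_lt {n : ℕ} (h : ∀ w : List ι, w.Nodup → w ≠ [] → w.length < n →
    ∀ φ : wordObj X w ⟶ A, φ = 0) {a b : ι} {R : List ι} (hw : (a :: b :: R).Nodup)
    (hR : R ≠ []) (hn : (a :: b :: R).length = n) (φ : wordObj X (a :: b :: R) ⟶ A) : φ = 0 := by
  have hp : (a :: b :: R).Perm ((b :: R) ++ [a]) :=
    (List.perm_append_singleton a (b :: R)).symm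
  obtain ⟨e⟩ := nonempty_wordObj_iso_of_perm X hp
  rw [← cancel_epi e.inv, comp_zero]
  refine hX.hom_word_append_eq_zero (b :: R) [a] (fun f => ?_) _
  by_contra hf
  have hbR : (b :: R).Nodup := hw.of_cons
  have hba : [b, a].Nodup := by
    simp only [List.nodup_cons, List.mem_cons, not_or] at hw ⊢
    simpa using Ne.symm hw.1.1
  have hRl := List.length_pos_of_ne_nil hR
  simp only [List.length_cons] at hn
  obtain ⟨g, hg⟩ := hX.exists_section hbR (freeExt f ≫ _ ◁ algTraceForm A ≫ (ρ_ _).hom)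
    fun h0 => hf (hA'.eq_zero_of_freeExt_comp f h0)
  have hW : 𝟙 (wordObj X (b :: R)) ≠ 0 := fun h0 => hf <| by
    rw [← Category.comp_id f, ← id_whiskerRight, h0]
    simp
  have hgf : g ≫ freeExt f ≠ 0 := fun h0 => hW <| by
    rw [← hg, reassoc_of% h0, zero_comp]
  have h1 := hX.exists_eq_smul_one hA hA'
  obtain ⟨ψ, hψ⟩ := hX.hom_word_eq_smul h1 h (b :: R) hbR (by simp only [List.length_cons]; omega)
  -- Both maps lie on the line spanned by `ψ` and the first is nonzero, so `g` rescales to a section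
  -- of module maps.
  obtain ⟨c, hc⟩ : ∃ c : k, c • (g ≫ freeExt f) = freeUnit _ A := by
    obtain ⟨x, hx⟩ := hψ (g ≫ freeExt f)
    obtain ⟨y, hy⟩ := hψ (freeUnit _ A)
    have hx0 : x ≠ 0 := fun h0 => hgf (by rw [hx, h0, zero_smul])
    exact ⟨y * x⁻¹, by rw [hx, hy, smul_smul, mul_assoc, inv_mul_cancel₀ hx0, mul_one]⟩
  obtain ⟨r, hr⟩ := hX.exists_retraction_one hA hA'
  -- Here `R ≠ []` is essential: it makes the length 2 of `[b, a]` smaller than `n`.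
  obtain ⟨ψ', hψ'⟩ := hX.hom_word_eq_smul h1 h [b, a] hba
    (by simp only [List.length_cons, List.length_nil]; omega)
  obtain ⟨E, hE⟩ := hX.exists_end_ne_smul (b := b) (Z := wordObj X R) hW
  obtain ⟨x, hx⟩ := end_eq_smul_of_freeExt_section hr f (c • g)
    (by rw [Linear.smul_comp, hc]) (X b) hψ' E
  exact hE x hx

variable (hA'' : IsRibbonAlg A)
include hA''

/-- Lengths 1 and 2 are excluded by naturality of the twist, and longer words by the retract
argument under strong induction. -/
theorem hom_word_eq_zero (w : List ι) (hw : w.Nodup) (hw0 : w ≠ []) (φ : wordObj X w ⟶ A) :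
    φ = 0 := by
  induction hn : w.length using Nat.strong_induction_on generalizing w with
  | _ n ih =>
    by_cases hl : w.length = 1 ∨ w.length = 2
    · obtain ⟨c, hc, ht⟩ := hX.twist w hw hl
      have h1 := ribbonTwist_naturality φ
      rw [ht, show ribbonTwist A = 𝟙 A from hA'', Category.comp_id, Linear.smul_comp,
        Category.id_comp] at h1
      have h2 : (c - 1) • φ = 0 := by rw [sub_smul, one_smul, ← h1, sub_self]
      exact (smul_eq_zero.1 h2).resolve_left (sub_ne_zero.2 hc)
    · match w, hw, hw0, hl, φ, hn with
      | [], _, hw0, _, _, _ => exact absurd rfl hw0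
      | [_], _, _, hl, _, _ => simp at hl
      | a :: b :: R, hw, _, hl, φ, hn =>
        refine hX.hom_word_eq_zero_of_lt hA hA' (fun w' h1 h2 h3 φ' => ih _ h3 w' h1 h2 φ' rfl)
          hw ?_ hn φ
        rintro rfl
        simp at hl

/-- In a decomposition of `A` into words, only the empty word maps nontrivially to `A`, and only by
multiples of the unit. So the identity of `A` factors through the unit map, and scalar endomorphisms
of `𝟙` make this one-sided inverse two-sided. -/
theorem isIso_one : IsIso (MonObj.one (X := A)) := by
  obtain ⟨n, V, p, i, hV, hpi⟩ := hX.decomposes A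
  have hfac : ∀ a, ∃ s : V a ⟶ 𝟙_ D, i a = s ≫ MonObj.one (X := A) := fun a => by
    obtain ⟨w, hw, h⟩ := hV a
    generalize i a = i'
    revert i'
    rw [h]
    intro i'
    by_cases hw0 : w = []
    · subst hw0
      change 𝟙_ D ⟶ A at i'
      change ∃ s : 𝟙_ D ⟶ 𝟙_ D, i' = s ≫ MonObj.one (X := A)
      obtain ⟨c, hc⟩ := hX.exists_eq_smul_one hA hA' i'
      exact ⟨c • 𝟙 _, by rw [hc]; simp⟩
    · exact ⟨0, by rw [hX.hom_word_eq_zero hA hA' hA'' w hw hw0 i', zero_comp]⟩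
  choose s hs using hfac
  have hr : (∑ a, p a ≫ s a) ≫ MonObj.one (X := A) = 𝟙 A := by
    rw [← hpi, Preadditive.sum_comp]
    exact Finset.sum_congr rfl fun a _ => by rw [Category.assoc, ← hs]
  set r := ∑ a, p a ≫ s a
  obtain ⟨c, hc⟩ := hX.end_unit (MonObj.one (X := A) ≫ r)
  have h0 : MonObj.one (X := A) ≠ 0 := fun h => hA.1 <| (IsZero.iff_id_eq_zero A).2 <| by
    rw [← hr, h, comp_zero]
  have h1 : (c - 1) • MonObj.one (X := A) = 0 := by
    have h2 : c • MonObj.one (X := A) = MonObj.one (X := A) ≫ r ≫ MonObj.one (X := A) := by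
      rw [← Category.assoc, hc]; simp
    rw [hr, Category.comp_id] at h2
    rw [sub_smul, h2, one_smul, sub_self]
  refine ⟨r, ?_, hr⟩
  rw [hc, sub_eq_zero.1 ((smul_eq_zero.1 h1).resolve_right h0), one_smul]

end

end IsFibonacciFamily

theorem theorem4p4 {k : Type w} [Field k] [IsAlgClosed k] [CharZero k]
    {F : Type u} [Category.{v} F] [Abelian F] [Linear k F] [MonoidalCategory F]
    [MonoidalPreadditive F] [MonoidalLinear k F] [BraidedCategory F] [RigidCategory F]
    [RibbonTwist F] (u : k) (hF : IsFibonacci k F u) (l : ℕ)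
    {D : Type u'} [Category.{v'} D] [Abelian D] [Linear k D] [MonoidalCategory D]
    [MonoidalPreadditive D] [MonoidalLinear k D] [BraidedCategory D] [RigidCategory D]
    [RibbonTwist D] (hD : DeligneProduct k (fun _ : Fin l => F) D) :
    IsCompletelyAnisotropic D := by
  intro A _ _ hA hA' hA''
  obtain ⟨X, θ, hX, hθ, hθ1, hθ2⟩ := hF.exists_fibonacciObject
  exact (hD.isFibonacciFamily hX hθ hθ1 hθ2).isIso_one hA hA' hA''
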